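/- All groups are additively written abelian groups. A group $H$ is *generalized co-Hopfian* if for every injective endomorphism $\phi:H\to H$ the image $\phi(H)$ is a direct summand of $H$; it is *generalized co-Bassian* if for every subgroup $N\le H$ and every injective homomorphism $\varphi:H\to H/N$ the image $\varphi(H)$ is a direct summand of $H/N$. A group $G$ is *super generalized co-Hopfian* (respectively, *super generalized co-Bassian*) if every epimorphic image of $G$ is generalized co-Hopfian (respectively, generalized co-Bassian). For a prime $p$, the $p$-rank of a group $A$ is the dimension of $A[p]=\{x\in A: px=0\}$ over the field with $p$ elements, and the rank of a torsion-free group is the maximal cardinality of a $\mathbb{Z}$-linearly independent subset. **Theorem.** Let $G$ be an abelian group with torsion subgroup $T$ and, for each prime $p$, let $T_p$ be the $p$-primary component of $T$. The following are equivalent: (a) $G$ is super generalized co-Bassian; (b) $G$ is super generalized co-Hopfian; (c) one of the following two conditions holds: (1) $G$ is divisible; (2) $G/T$ is torsion-free divisible of finite rank and, for each prime $p$, either $T_p$ is divisible or $pT_p$ has finite $p$-rank. -/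

import Mathlib

universe u

namespace AbGroup

/-- A subgroup `A` of `G` is a direct summand if `G = A ⊕ C` for some subgroup `C`. -/
def IsDirectSummand {G : Type u} [AddCommGroup G] (A : AddSubgroup G) : Prop :=
  ∃ C : AddSubgroup G, IsCompl A C

/-- Every injective endomorphism has an image that is a direct summand. -/
def IsGeneralizedCoHopfian (G : Type u) [AddCommGroup G] : Prop :=
  ∀ φ : G →+ G, Function.Injective φ → IsDirectSummand φ.range

/-- For every subgroup `N`, every injective homomorphism `G → G/N` has an image that is a direct
summand of `G/N`. -/
def IsGeneralizedCoBassian (G : Type u) [AddCommGroup G] : Prop :=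
  ∀ (N : AddSubgroup G) (φ : G →+ G ⧸ N), Function.Injective φ → IsDirectSummand φ.range

/-- Every epimorphic image is generalized co-Hopfian. -/
def IsSuperGeneralizedCoHopfian (G : Type u) [AddCommGroup G] : Prop :=
  ∀ (H : Type u) [AddCommGroup H] (f : G →+ H), Function.Surjective f → IsGeneralizedCoHopfian H

/-- Every epimorphic image is generalized co-Bassian. -/
def IsSuperGeneralizedCoBassian (G : Type u) [AddCommGroup G] : Prop :=
  ∀ (H : Type u) [AddCommGroup H] (f : G →+ H), Function.Surjective f → IsGeneralizedCoBassian H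

/-- `G` is divisible: `nG = G` for every nonzero integer `n`. -/
def IsDivisible (G : Type u) [AddCommGroup G] : Prop :=
  ∀ n : ℤ, n ≠ 0 → ∀ x : G, ∃ y : G, n • y = x

/-- The torsion-free rank of `G`: the supremum of the cardinalities of its `ℤ`-linearly
independent subsets (the rank of `G` when `G` is torsion-free). -/
noncomputable def torsionFreeRank (G : Type u) [AddCommGroup G] : Cardinal.{u} :=
  Module.rank ℤ G

/-- The `p`-rank of `G`: the dimension of the socle `G[p] = {x | p x = 0}` over the field with
`p` elements. -/
noncomputable def pRank (p : ℕ) (G : Type u) [AddCommGroup G] : Cardinal.{u} :=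
  letI : Module (ZMod p) (AddSubgroup.torsionBy G (p : ℤ)) := AddSubgroup.torsionBy.zmodModule
  Module.rank (ZMod p) (AddSubgroup.torsionBy G (p : ℤ))

/-- The `p`-component `T_p` of the torsion subgroup `T` of `G`: the subgroup of the elements of `G`
whose order is a power of `p`. -/
def torsionComponent (G : Type u) [AddCommGroup G] (p : ℕ) [Fact p.Prime] : AddSubgroup G :=
  AddCommGroup.primaryComponent G p

/-- The subgroup `nA = {n a | a ∈ A}` of `G`, for a subgroup `A` of `G`. -/
def multiple {G : Type u} [AddCommGroup G] (n : ℕ) (A : AddSubgroup G) : AddSubgroup G :=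
  A.map (nsmulAddMonoidHom n)

end AbGroup

namespace AbGroup

/-! Sufficiency. Divisible groups are injective, and divisibility passes to quotients, so in case
(1) every embedding splits. In case (2), write Q = H/N for an image H of G. Finite rank makes the
cokernel of an embedding φ : H → Q torsion, so splitting can be tested one prime at a time
(`isDirectSummand_of_primary`). The kernel N is torsion as well, so the p-component R of Q is the
image of the p-component P of H. If P is divisible, φ splits on P. Otherwise pP has finite socle;
counting torsion shows that φ maps pP onto pR, hence R = φ(P) + R[p], and a vector space complement
inside R[p] finishes. The count rests on `finite_ker_nsmul_of_surjective`: finite n-torsion survives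
in quotients of groups of finite rank, with an explicit bound.

Necessity. One family of groups is the obstruction: ZMod p ⊕ B^(ℕ), where B has an element of order
p². A shift embeds this group in itself with an image that is not pure
(`not_isGeneralizedCoHopfian_zmod_prod_finsupp`). With B the Prüfer group, it follows that if G maps
onto Prüfer^(ℕ), then G is p-divisible. Infinite torsion-free rank gives such a map for every p, and
a p-divisible subgroup with infinite socle gives one for that p. With B = ZMod (p²), it follows that
p(G/p²G) is finite, and this is what produces such a subgroup inside pT_p when pT_p has infinite
p-rank. -/

/-! ### Direct summands and divisible groups. -/

theorem isDirectSummand_range_of_leftInverse {H Q : Type*} [AddCommGroup H] [AddCommGroup Q]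
    (φ : H →+ Q) (r : Q →+ H) (h : ∀ x, r (φ x) = x) : IsDirectSummand φ.range := by
  refine ⟨r.ker, ?_, ?_⟩
  · rw [AddSubgroup.disjoint_def]
    rintro _ ⟨x, rfl⟩ hx
    have : x = 0 := by simpa [AddMonoidHom.mem_ker, h] using hx
    simp [this]
  · rw [codisjoint_iff, eq_top_iff]
    intro y _
    refine AddSubgroup.mem_sup.2 ⟨φ (r y), ⟨_, rfl⟩, y - φ (r y), ?_, by abel⟩
    simp [AddMonoidHom.mem_ker, h]

theorem IsDivisible.exists_extension {D A B : Type*} [AddCommGroup D] [AddCommGroup A]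
    [AddCommGroup B] (hD : IsDivisible D) (i : A →+ B) (hi : Function.Injective i) (f : A →+ D) :
    ∃ g : B →+ D, ∀ a, g (i a) = f a := by
  classical
  let : DivisibleBy D ℤ :=
    { div := fun x n => if h : n = 0 then 0 else (hD n h x).choose
      div_zero := fun x => by simp
      div_cancel := fun {n} x h => by simpa [h] using (hD n h x).choose_spec }
  obtain ⟨g, hg⟩ := (Module.Baer.of_divisible D).extension_property_addMonoidHom i hi f
  exact ⟨g, fun a => DFunLike.congr_fun hg a⟩

theorem IsDivisible.of_surjective {G H : Type*} [AddCommGroup G] [AddCommGroup H]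
    (hG : IsDivisible G) (f : G →+ H) (hf : Function.Surjective f) : IsDivisible H := by
  intro n hn y
  obtain ⟨x, rfl⟩ := hf y
  obtain ⟨z, rfl⟩ := hG n hn x
  exact ⟨f z, by simp⟩

theorem IsDivisible.isDirectSummand_range {H Q : Type*} [AddCommGroup H] [AddCommGroup Q]
    (hH : IsDivisible H) (φ : H →+ Q) (hφ : Function.Injective φ) : IsDirectSummand φ.range := by
  obtain ⟨r, hr⟩ := hH.exists_extension φ hφ (AddMonoidHom.id H)
  exact isDirectSummand_range_of_leftInverse φ r hr

theorem IsDivisible.isGeneralizedCoBassian {H : Type*} [AddCommGroup H]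
    (hH : IsDivisible H) : IsGeneralizedCoBassian H :=
  fun _ φ hφ => hH.isDirectSummand_range φ hφ

/-- Divisibility by all primes suffices. -/
theorem isDivisible_of_forall_prime {G : Type*} [AddCommGroup G]
    (h : ∀ p : ℕ, p.Prime → ∀ x : G, ∃ y : G, p • y = x) : IsDivisible G := by
  have key : ∀ n : ℕ, n ≠ 0 → ∀ x : G, ∃ y : G, n • y = x := by
    intro n
    induction n using Nat.recOnMul with
    | zero => exact fun h => absurd rfl h
    | one => exact fun _ x => ⟨x, by simp⟩
    | prime p hp => exact fun _ => h p hp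
    | mul a b ha hb =>
      intro hab x
      obtain ⟨y, rfl⟩ := ha (left_ne_zero_of_mul hab) x
      obtain ⟨z, rfl⟩ := hb (right_ne_zero_of_mul hab) y
      exact ⟨z, by rw [mul_smul]⟩
  intro n hn x
  obtain ⟨y, hy⟩ := key n.natAbs (by simpa using hn) x
  rcases Int.natAbs_eq n with h | h
  · exact ⟨y, by rw [h, natCast_zsmul, hy]⟩
  · exact ⟨-y, by rw [h, neg_smul, smul_neg, neg_neg, natCast_zsmul, hy]⟩

/-! ### Counting n-torsion in quotients. -/

theorem index_nsmul_range_eq_card_ker {T : Type*} [AddCommGroup T] [Finite T] (n : ℕ) :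
    (nsmulAddMonoidHom n : T →+ T).range.index = Nat.card (nsmulAddMonoidHom n : T →+ T).ker := by
  have h1 := (nsmulAddMonoidHom n : T →+ T).range.card_mul_index
  have h2 := (nsmulAddMonoidHom n : T →+ T).ker.card_mul_index
  rw [AddSubgroup.index_ker] at h2
  have : 0 < Nat.card (nsmulAddMonoidHom n : T →+ T).range := Nat.card_pos
  nlinarith

/-- Write B = ℤ^r ⊕ T with T finite. Then |B/nB| = n^r |T/nT| = n^r |T[n]|, while r is at most the
rank of B and T[n] embeds in B[n]. -/
theorem index_nsmul_range_le_of_fg {B : Type*} [AddCommGroup B] [AddGroup.FG B] {n : ℕ}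
    (hn : n ≠ 0) :
    (nsmulAddMonoidHom n : B →+ B).range.index ≠ 0 ∧
      (nsmulAddMonoidHom n : B →+ B).range.index ≤
        n ^ Module.finrank ℤ B * Nat.card (nsmulAddMonoidHom n : B →+ B).ker := by
  classical
  have : NeZero n := ⟨hn⟩
  have : Module.Finite ℤ B := Module.Finite.iff_addGroup_fg.2 inferInstance
  obtain ⟨r, ι, _, p, hp, e, ⟨E⟩⟩ := AddCommGroup.equiv_free_prod_directSum_zmod B
  set T := DirectSum ι (fun i => ZMod (p i ^ e i)) with hT
  have : ∀ i, NeZero (p i ^ e i) := fun i => ⟨pow_ne_zero _ (hp i).ne_zero⟩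
  have : Finite T := Finite.of_equiv _ (DirectSum.addEquivProd fun i => ZMod (p i ^ e i)).symm.toEquiv
  let N : AddSubgroup T := (nsmulAddMonoidHom n : T →+ T).range
  let a : (Fin r →₀ ℤ) →+ (Fin r → ZMod n) :=
    AddMonoidHom.mk' (fun v i => (v i : ZMod n)) (by intro x y; ext i; simp)
  let g : B →+ (Fin r → ZMod n) × (T ⧸ N) := (a.prodMap (QuotientAddGroup.mk' N)).comp E
  have hker : g.ker ≤ (nsmulAddMonoidHom n : B →+ B).range := by
    intro x hx
    rw [AddMonoidHom.mem_ker] at hx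
    have h1 : a (E x).1 = 0 := congrArg Prod.fst hx
    have h2 : QuotientAddGroup.mk' N (E x).2 = 0 := congrArg Prod.snd hx
    have h3 : ∀ i, ∃ c : ℤ, (E x).1 i = n * c := fun i =>
      (ZMod.intCast_zmod_eq_zero_iff_dvd _ _).1 (congrFun h1 i)
    choose c hc using h3
    obtain ⟨s, hs⟩ : (E x).2 ∈ N := (QuotientAddGroup.eq_zero_iff _).1 h2
    refine ⟨E.symm (Finsupp.equivFunOnFinite.symm c, s), ?_⟩
    apply E.injective
    change E (n • E.symm _) = _
    rw [map_nsmul, E.apply_symm_apply]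
    refine Prod.ext ?_ hs
    ext i
    simp [hc]
  have hfin : g.ker.index ≠ 0 := by
    rw [AddSubgroup.index_ker]; exact Nat.card_pos.ne'
  have hdvd := AddSubgroup.index_dvd_of_le hker
  refine ⟨fun h => hfin (Nat.eq_zero_of_zero_dvd (h ▸ hdvd)), ?_⟩
  refine (Nat.le_of_dvd (Nat.pos_of_ne_zero hfin) hdvd).trans ?_
  have hr : r ≤ Module.finrank ℤ B := by
    let j : (Fin r →₀ ℤ) →+ B := E.symm.toAddMonoidHom.comp (AddMonoidHom.inl _ _)
    have hj : Function.Injective j.toIntLinearMap :=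
      E.symm.injective.comp (fun x y h => congrArg Prod.fst h)
    simpa using LinearMap.finrank_le_finrank_of_injective hj
  have hk : Nat.card (nsmulAddMonoidHom n : T →+ T).ker ≤
      Nat.card (nsmulAddMonoidHom n : B →+ B).ker := by
    have : Finite (nsmulAddMonoidHom n : B →+ B).ker := by
      let q : (nsmulAddMonoidHom n : B →+ B).ker → T := fun x => (E x).2
      refine Finite.of_injective q ?_
      rintro ⟨x, hx⟩ ⟨y, hy⟩ hxy
      have hz : ∀ x : B, n • x = 0 → (E x).1 = 0 := by
        intro x hx
        have : n • (E x).1 = 0 := by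
          have := congrArg Prod.fst (congrArg E hx)
          simpa using this
        exact (smul_eq_zero.1 this).resolve_left hn
      exact Subtype.ext (E.injective (Prod.ext ((hz x hx).trans (hz y hy).symm) hxy))
    refine Nat.card_le_card_of_injective
      (fun t => (⟨E.symm (0, t.1), ?_⟩ : (nsmulAddMonoidHom n : B →+ B).ker)) ?_
    · have ht : n • (t : T) = 0 := t.2
      change n • E.symm (0, (t : T)) = 0
      rw [← map_nsmul, Prod.smul_mk, ht]; simp
    · intro s t hst
      have := E.symm.injective (congrArg Subtype.val hst)
      exact Subtype.ext (congrArg Prod.snd this)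
  calc g.ker.index = Nat.card g.range := AddSubgroup.index_ker _
    _ ≤ Nat.card ((Fin r → ZMod n) × (T ⧸ N)) := Nat.card_le_card_of_injective _ Subtype.val_injective
    _ = n ^ r * Nat.card (nsmulAddMonoidHom n : T →+ T).ker := by
        rw [Nat.card_prod, ← index_nsmul_range_eq_card_ker]
        simp [AddSubgroup.index, N]
    _ ≤ _ := Nat.mul_le_mul (Nat.pow_le_pow_right (Nat.pos_of_ne_zero hn) hr) hk

/-- In a group of finite torsion-free rank with finite `n`-torsion, every quotient has finite
`n`-torsion, of bounded size. -/
theorem finite_ker_nsmul_of_surjective {G H : Type*} [AddCommGroup G] [AddCommGroup H]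
    (f : G →+ H) (hf : Function.Surjective f) {n : ℕ} (hn : n ≠ 0)
    (hrank : Module.rank ℤ G < Cardinal.aleph0)
    [Finite (nsmulAddMonoidHom n : G →+ G).ker] :
    Finite (nsmulAddMonoidHom n : H →+ H).ker ∧ Nat.card (nsmulAddMonoidHom n : H →+ H).ker ≤
      n ^ Module.finrank ℤ G * Nat.card (nsmulAddMonoidHom n : G →+ G).ker := by
  classical
  -- Lift a finite set Y of n-torsion elements to a finitely generated subgroup E of G. Its image in
  -- H is killed by n, hence is a quotient of E/nE, and the size of E/nE is bounded in terms of G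
  -- alone.
  have key : ∀ Y : Finset (nsmulAddMonoidHom n : H →+ H).ker, Y.card ≤
      n ^ Module.finrank ℤ G * Nat.card (nsmulAddMonoidHom n : G →+ G).ker := by
    intro Y
    choose s hs using hf
    let E : AddSubgroup G := AddSubgroup.closure
      ((Y.image fun y : (nsmulAddMonoidHom n : H →+ H).ker => s (y : H) : Finset G) : Set G)
    have : AddGroup.FG E :=
      (AddGroup.fg_iff_addSubgroup_fg E).2 ⟨_, rfl⟩
    let fE : E →+ H := f.comp E.subtype
    have hEn : ∀ x ∈ E, n • f x = 0 := by
      intro x hx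
      induction hx using AddSubgroup.closure_induction with
      | mem x hx =>
        obtain ⟨y, _, rfl⟩ := Finset.mem_image.1 hx
        rw [hs]; exact y.2
      | zero => simp
      | add x y _ _ hx hy => simp [smul_add, hx, hy]
      | neg x _ hx => simp [hx]
    have hle : (nsmulAddMonoidHom n : E →+ E).range ≤ fE.ker := by
      rintro _ ⟨x, rfl⟩
      rw [AddMonoidHom.mem_ker]
      change fE (n • x) = 0
      rw [map_nsmul]
      exact hEn x x.2
    obtain ⟨h0, h1⟩ := index_nsmul_range_le_of_fg (B := E) hn
    have hdvd := AddSubgroup.index_dvd_of_le hle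
    have hker0 : fE.ker.index ≠ 0 := fun h => h0 (Nat.eq_zero_of_zero_dvd (h ▸ hdvd))
    rw [AddSubgroup.index_ker] at hker0
    have : Finite fE.range := Nat.finite_of_card_ne_zero hker0
    have hY : Y.card ≤ Nat.card fE.range := by
      rw [← (Nat.card_eq_fintype_card.trans (Fintype.card_coe Y))]
      refine Nat.card_le_card_of_injective (fun y : Y => (⟨(y : (nsmulAddMonoidHom n : H →+ H).ker),
        ⟨s (y : (nsmulAddMonoidHom n : H →+ H).ker), AddSubgroup.subset_closure
          (Finset.mem_image_of_mem _ y.2)⟩, hs _⟩ : fE.range)) ?_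
      intro x y hxy
      exact Subtype.ext (Subtype.ext (congrArg (fun z : fE.range => (z : H)) hxy))
    have hkE : Nat.card (nsmulAddMonoidHom n : E →+ E).ker ≤
        Nat.card (nsmulAddMonoidHom n : G →+ G).ker := by
      refine Nat.card_le_card_of_injective
        (fun x => (⟨(x : E), congrArg Subtype.val (show n • (x : E) = 0 from x.2)⟩ :
          (nsmulAddMonoidHom n : G →+ G).ker)) ?_
      intro x y hxy
      exact Subtype.ext (Subtype.ext (congrArg (fun z : (nsmulAddMonoidHom n : G →+ G).ker => (z : G)) hxy))
    have hrE : Module.finrank ℤ E ≤ Module.finrank ℤ G := by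
      refine Cardinal.toNat_le_toNat ?_ hrank
      exact LinearMap.rank_le_of_injective E.subtype.toIntLinearMap Subtype.val_injective
    calc Y.card ≤ Nat.card fE.range := hY
      _ = fE.ker.index := (AddSubgroup.index_ker _).symm
      _ ≤ _ := Nat.le_of_dvd (Nat.pos_of_ne_zero h0) hdvd
      _ ≤ _ := h1
      _ ≤ _ := Nat.mul_le_mul (Nat.pow_le_pow_right (Nat.pos_of_ne_zero hn) hrE) hkE
  have hfin : Finite (nsmulAddMonoidHom n : H →+ H).ker := by
    by_contra hinf
    rw [not_finite_iff_infinite] at hinf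
    obtain ⟨Y, hY⟩ := Infinite.exists_subset_card_eq (nsmulAddMonoidHom n : H →+ H).ker
      (n ^ Module.finrank ℤ G * Nat.card (nsmulAddMonoidHom n : G →+ G).ker + 1)
    have := key Y
    omega
  refine ⟨hfin, ?_⟩
  have := Fintype.ofFinite (nsmulAddMonoidHom n : H →+ H).ker
  rw [Nat.card_eq_fintype_card (α := (nsmulAddMonoidHom n : H →+ H).ker)]
  exact key Finset.univ

/-! ### Splitting one prime at a time, and the case of p-groups. -/

/-- A subgroup `R` of `Q` with torsion quotient is a direct summand as soon as it is so in the
preimage of every primary component of the quotient. -/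
theorem isDirectSummand_of_primary {Q : Type*} [AddCommGroup Q] (R : AddSubgroup Q)
    (htor : ∀ y : Q, ∃ n : ℕ, n ≠ 0 ∧ n • y ∈ R)
    (h : ∀ p : ℕ, p.Prime → ∃ S : AddSubgroup Q, (∀ x ∈ S, ∃ k : ℕ, p ^ k • x = 0) ∧
      Disjoint S R ∧ ∀ (y : Q) (k : ℕ), p ^ k • y ∈ R → y ∈ R ⊔ S) :
    IsDirectSummand R := by
  choose S hS1 hS2 hS3 using h
  let C : AddSubgroup Q := ⨆ p : Nat.Primes, S p p.2
  have hC : ∀ x ∈ C, ∀ p : Nat.Primes, ∃ m : ℕ, m.Coprime p ∧ m • x ∈ S p p.2 := by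
    intro x hx p
    refine AddSubgroup.iSup_induction (fun p : Nat.Primes => S p p.2)
      (C := fun x => ∃ m : ℕ, m.Coprime p ∧ m • x ∈ S p p.2) hx ?_ ?_ ?_
    · intro q x hx
      by_cases hpq : q = p
      · subst hpq
        exact ⟨1, Nat.coprime_one_left _, by simpa using hx⟩
      · obtain ⟨k, hk⟩ := hS1 q q.2 x hx
        refine ⟨(q : ℕ) ^ k, Nat.Coprime.pow_left _ ?_, by rw [hk]; exact zero_mem _⟩
        exact (Nat.coprime_primes q.2 p.2).2 fun h => hpq (Subtype.ext h)
    · exact ⟨1, Nat.coprime_one_left _, by simp⟩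
    · rintro x y ⟨a, ha, hax⟩ ⟨b, hb, hby⟩
      refine ⟨a * b, ha.mul_left hb, ?_⟩
      rw [smul_add, mul_smul, mul_smul, smul_comm a b x]
      exact add_mem (nsmul_mem hax _) (nsmul_mem hby _)
  refine ⟨C, ?_, ?_⟩
  · rw [AddSubgroup.disjoint_def]
    intro x hxR hxC
    -- No prime divides the order of x. Infinite order, encoded as 0, is excluded too, since every
    -- prime divides 0.
    rw [← AddMonoid.addOrderOf_eq_one_iff, Nat.eq_one_iff_not_exists_prime_dvd]
    intro p hp hdvd
    obtain ⟨m, hm, hmx⟩ := hC x hxC ⟨p, hp⟩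
    have h0 : m • x = 0 := (AddSubgroup.disjoint_def.1 (hS2 p hp)) hmx (nsmul_mem hxR m)
    have h1 : p ∣ m := hdvd.trans (addOrderOf_dvd_iff_nsmul_eq_zero.2 h0)
    exact hp.one_lt.ne' (Nat.eq_one_of_dvd_coprimes hm h1 dvd_rfl)
  · rw [codisjoint_iff, eq_top_iff]
    have key : ∀ n : ℕ, n ≠ 0 → ∀ y : Q, n • y ∈ R → y ∈ R ⊔ C := by
      intro n
      induction n using Nat.recOnPosPrimePosCoprime with
      | zero => exact fun h => absurd rfl h
      | one => exact fun _ y hy => (le_sup_left : R ≤ R ⊔ C) (by simpa using hy)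
      | prime_pow p k hp _ =>
        intro _ y hy
        exact sup_le_sup_left (le_iSup (fun p : Nat.Primes => S p p.2) ⟨p, hp⟩) R
          (hS3 p hp y k hy)
      | coprime a b ha hb hab iha ihb =>
        intro _ y hy
        have h1 : b • y ∈ R ⊔ C := iha (by omega) _ (by rwa [← mul_smul])
        have h2 : a • y ∈ R ⊔ C := ihb (by omega) _ (by rwa [← mul_smul, mul_comm])
        have h3 : y = a.gcdA b • (a • y) + a.gcdB b • (b • y) := by
          have := Nat.gcd_eq_gcd_ab a b
          rw [hab.gcd_eq_one] at this
          rw [← natCast_zsmul y a, ← natCast_zsmul y b, ← mul_smul, ← mul_smul, ← add_smul,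
            mul_comm _ (a : ℤ), mul_comm _ (b : ℤ), ← this]
          simp
        rw [h3]
        exact add_mem (zsmul_mem h2 _) (zsmul_mem h1 _)
    intro y _
    obtain ⟨n, hn, hy⟩ := htor y
    exact key n hn y hy

theorem exists_isCompl_of_zmodModule {p : ℕ} [Fact p.Prime] {V : Type*} [AddCommGroup V]
    [Module (ZMod p) V] (W : AddSubgroup V) : ∃ W' : AddSubgroup V, IsCompl W W' :=
  have := (AddSubgroup.toZModSubmodule (M := V) p).complementedLattice_iff.2 inferInstance
  exists_isCompl W

theorem finite_ker_nsmul_pow {B : Type*} [AddCommGroup B] (p : ℕ)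
    [Finite (nsmulAddMonoidHom p : B →+ B).ker] (k : ℕ) :
    Finite (nsmulAddMonoidHom (p ^ k) : B →+ B).ker := by
  induction k with
  | zero =>
    have : (nsmulAddMonoidHom (p ^ 0) : B →+ B).ker = ⊥ := by
      ext x; simp [AddMonoidHom.mem_ker]
    rw [this]; infer_instance
  | succ k ih =>
    let A := (nsmulAddMonoidHom (p ^ (k + 1)) : B →+ B).ker
    let f : A →+ (nsmulAddMonoidHom (p ^ k) : B →+ B).ker :=
      ((nsmulAddMonoidHom p).comp A.subtype).codRestrict _ (by
        rintro ⟨x, hx⟩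
        change p ^ k • (p • x) = 0
        rw [← mul_smul, ← pow_succ]
        exact hx)
    have : Finite f.ker := by
      refine Finite.of_injective
        (fun x => (⟨(x : A), congrArg Subtype.val x.2⟩ : (nsmulAddMonoidHom p : B →+ B).ker)) ?_
      intro x y hxy
      exact Subtype.ext (Subtype.ext
        (congrArg (fun z : (nsmulAddMonoidHom p : B →+ B).ker => (z : B)) hxy))
    refine Nat.finite_of_card_ne_zero (α := A) ?_
    rw [← f.ker.card_mul_index, AddSubgroup.index_ker]
    exact mul_ne_zero Nat.card_pos.ne' Nat.card_pos.ne'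

/-- For a `p`-group `P` with finite `p`-torsion and a quotient `R` of `P`, every injection of `P`
into `R` is onto. -/
theorem surjective_of_injective_of_finite_ker_nsmul {p : ℕ} (hp : p.Prime) {P R : Type*}
    [AddCommGroup P] [AddCommGroup R] (hP : ∀ x : P, ∃ k : ℕ, p ^ k • x = 0)
    [Finite (nsmulAddMonoidHom p : P →+ P).ker] (f : P →+ R) (hf : Function.Surjective f)
    (φ : P →+ R) (hφ : Function.Injective φ) : Function.Surjective φ := by
  have hrank : Module.rank ℤ P = 0 := by
    rw [rank_eq_zero_iff]
    intro x
    obtain ⟨k, hk⟩ := hP x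
    refine ⟨(p ^ k : ℕ), by exact_mod_cast pow_ne_zero _ hp.ne_zero, ?_⟩
    rwa [natCast_zsmul]
  intro y
  obtain ⟨x, rfl⟩ := hf y
  obtain ⟨k, hk⟩ := hP x
  have := finite_ker_nsmul_pow (B := P) p k
  obtain ⟨hfin, hcard⟩ := finite_ker_nsmul_of_surjective f hf (pow_ne_zero k hp.ne_zero)
    (by rw [hrank]; exact Cardinal.aleph0_pos)
  have h0 : Module.finrank ℤ P = 0 := by simp [Module.finrank, hrank]
  -- In rank 0 the bound reads |R[p^k]| ≤ |P[p^k]|, so the injection induced by φ on p^k-torsion is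
  -- a bijection of finite sets.
  rw [h0, pow_zero, one_mul] at hcard
  let g : (nsmulAddMonoidHom (p ^ k) : P →+ P).ker → (nsmulAddMonoidHom (p ^ k) : R →+ R).ker :=
    fun z => ⟨φ z, by
      change p ^ k • φ z = 0
      rw [← map_nsmul, show p ^ k • (z : P) = 0 from z.2, map_zero]⟩
  have hg : Function.Injective g := fun a b hab =>
    Subtype.ext (hφ (congrArg (fun z : (nsmulAddMonoidHom (p ^ k) : R →+ R).ker => (z : R)) hab))
  have hgs : Function.Surjective g :=
    ((Nat.bijective_iff_injective_and_card g).2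
      ⟨hg, le_antisymm (Nat.card_le_card_of_injective g hg) hcard⟩).2
  obtain ⟨z, hz⟩ := hgs ⟨f x, by
    change p ^ k • f x = 0
    rw [← map_nsmul, hk, map_zero]⟩
  exact ⟨z, congrArg (fun z : (nsmulAddMonoidHom (p ^ k) : R →+ R).ker => (z : R)) hz⟩

/-- By the torsion count φ maps pP onto pR, so each y in R differs from an element of φ(P) by an
element of R[p]. A complement of φ(P) ∩ R[p] in the vector space R[p] is therefore a complement of
φ(P) in R. -/
theorem isDirectSummand_range_of_pGroup {p : ℕ} [Fact p.Prime] {P R : Type*}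
    [AddCommGroup P] [AddCommGroup R] (hP : ∀ x : P, ∃ k : ℕ, p ^ k • x = 0)
    (hfin : Finite (nsmulAddMonoidHom p : (nsmulAddMonoidHom p : P →+ P).range →+ _).ker)
    (f : P →+ R) (hf : Function.Surjective f)
    (φ : P →+ R) (hφ : Function.Injective φ) : IsDirectSummand φ.range := by
  have hres : ∀ g : P →+ R, ∀ x : (nsmulAddMonoidHom p : P →+ P).range,
      g x ∈ (nsmulAddMonoidHom p : R →+ R).range := by
    rintro g ⟨_, x, rfl⟩
    exact ⟨g x, (map_nsmul g p x).symm⟩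
  let res : (P →+ R) → ((nsmulAddMonoidHom p : P →+ P).range →+
      (nsmulAddMonoidHom p : R →+ R).range) := fun g =>
    (g.comp (AddSubgroup.subtype _)).codRestrict _ (hres g)
  have hsurj : Function.Surjective (res φ) := by
    refine surjective_of_injective_of_finite_ker_nsmul (Fact.out : p.Prime) ?_ (res f) ?_ _ ?_
    · rintro ⟨x, hx⟩
      obtain ⟨k, hk⟩ := hP x
      exact ⟨k, Subtype.ext hk⟩
    · rintro ⟨_, y, rfl⟩
      obtain ⟨x, rfl⟩ := hf y
      exact ⟨⟨_, x, rfl⟩, Subtype.ext (map_nsmul f p x)⟩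
    · intro a b hab
      exact Subtype.ext (hφ (congrArg (fun z : (nsmulAddMonoidHom p : R →+ R).range => (z : R)) hab))
  let V := AddSubgroup.torsionBy R (p : ℤ)
  let _ : Module (ZMod p) V := AddSubgroup.torsionBy.zmodModule
  obtain ⟨W, hW⟩ := exists_isCompl_of_zmodModule (p := p) (φ.range.comap V.subtype)
  refine ⟨W.map V.subtype, ?_, ?_⟩
  · rw [AddSubgroup.disjoint_def]
    rintro _ hx ⟨w, hw, rfl⟩
    have := AddSubgroup.disjoint_def.1 hW.disjoint (x := w) hx hw
    simp [this]
  · rw [codisjoint_iff, eq_top_iff]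
    intro y _
    obtain ⟨⟨_, z, rfl⟩, hz⟩ := hsurj ⟨_, y, rfl⟩
    have hz' : φ (p • z) = p • y :=
      congrArg (fun z : (nsmulAddMonoidHom p : R →+ R).range => (z : R)) hz
    have hv : y - φ z ∈ V := by
      change (p : ℤ) • (y - φ z) = 0
      rw [natCast_zsmul, smul_sub, ← hz', map_nsmul, sub_self]
    have hv' : (⟨_, hv⟩ : V) ∈ φ.range.comap V.subtype ⊔ W := by
      rw [hW.sup_eq_top]; trivial
    obtain ⟨a, ha, b, hb, hab⟩ := AddSubgroup.mem_sup.1 hv'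
    refine AddSubgroup.mem_sup.2 ⟨φ z + a, add_mem ⟨z, rfl⟩ ha, b, ⟨b, hb, rfl⟩, ?_⟩
    have : (a : R) + b = y - φ z := congrArg (fun v : V => (v : R)) hab
    rw [add_assoc, this]; abel

theorem isDivisible_of_pGroup {p : ℕ} (hp : p.Prime) {P : Type*} [AddCommGroup P]
    (hP : ∀ x : P, ∃ k : ℕ, p ^ k • x = 0) (hdiv : ∀ x : P, ∃ y : P, p • y = x) :
    IsDivisible P := by
  refine isDivisible_of_forall_prime fun q hq x => ?_
  by_cases hpq : q = p
  · subst hpq; exact hdiv x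
  obtain ⟨k, hk⟩ := hP x
  have hcop : Nat.Coprime q (p ^ k) := ((Nat.coprime_primes hq hp).2 hpq).pow_right k
  have hb := Nat.gcd_eq_gcd_ab q (p ^ k)
  rw [hcop.gcd_eq_one] at hb
  refine ⟨q.gcdA (p ^ k) • x, ?_⟩
  calc q • q.gcdA (p ^ k) • x
      = ((q : ℤ) * q.gcdA (p ^ k)) • x + q.gcdB (p ^ k) • (p ^ k • x) := by
        rw [hk, smul_zero, add_zero, mul_smul, natCast_zsmul]
    _ = ((q : ℤ) * q.gcdA (p ^ k) + (p ^ k : ℕ) * q.gcdB (p ^ k)) • x := by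
        rw [add_smul, ← natCast_zsmul x (p ^ k), ← mul_smul, mul_comm (q.gcdB _)]
    _ = x := by rw [← hb]; simp

/-- A torsion element is the sum of a `p`-power multiple and of a `p`-primary element. -/
theorem exists_sub_smul_primary_of_isOfFinAddOrder {G : Type*} [AddCommGroup G] {p : ℕ}
    (hp : p.Prime) {t : G} (ht : IsOfFinAddOrder t) (k : ℕ) :
    ∃ (u : ℤ) (j : ℕ), p ^ j • (t - p ^ k • u • t) = 0 := by
  obtain ⟨m, hm, hmt⟩ := isOfFinAddOrder_iff_nsmul_eq_zero.1 ht
  obtain ⟨j, m', hm', rfl⟩ := Nat.exists_eq_pow_mul_and_not_dvd hm.ne' p hp.one_lt.ne'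
  have hcop : Nat.Coprime (p ^ k) m' := Nat.Coprime.pow_left k ((hp.coprime_iff_not_dvd).2 hm')
  have hb := Nat.gcd_eq_gcd_ab (p ^ k) m'
  rw [hcop.gcd_eq_one] at hb
  refine ⟨(p ^ k).gcdA m', j, ?_⟩
  have h1 : t - p ^ k • ((p ^ k).gcdA m' • t) = (p ^ k).gcdB m' • (m' • t) := by
    rw [sub_eq_iff_eq_add, ← natCast_zsmul _ (p ^ k), ← natCast_zsmul t m', ← mul_smul, ← mul_smul,
      ← add_smul, mul_comm _ (m' : ℤ), add_comm, ← hb]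
    simp
  rw [h1, smul_comm, ← mul_smul, hmt, smul_zero]

/-! ### Condition (2) in a form stable under quotients. -/

/-- An abelian group of finite torsion-free rank that is divisible modulo torsion and such that,
for every prime `p`, either `G` is `p`-divisible or `pG` has finite `p`-torsion. -/
structure IsNearlyDivisible (G : Type*) [AddCommGroup G] : Prop where
  rank_lt : Module.rank ℤ G < Cardinal.aleph0
  divisible_mod_torsion : ∀ n : ℕ, n ≠ 0 → ∀ x : G, ∃ y : G, IsOfFinAddOrder (n • y - x)
  divisible_or_finite : ∀ p : ℕ, p.Prime → (∀ x : G, ∃ y : G, p • y = x) ∨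
    Finite (nsmulAddMonoidHom p : (nsmulAddMonoidHom p : G →+ G).range →+ _).ker

/-- The p-component of a quotient need not be the image of the p-component, so the finiteness
condition concerns pG rather than pT_p. It descends by the torsion count, pG being of finite rank.
-/
theorem IsNearlyDivisible.of_surjective {G H : Type u} [AddCommGroup G] [AddCommGroup H]
    (hG : IsNearlyDivisible G) (f : G →+ H) (hf : Function.Surjective f) :
    IsNearlyDivisible H where
  rank_lt := (LinearMap.rank_le_of_surjective f.toIntLinearMap hf).trans_lt hG.rank_lt
  divisible_mod_torsion n hn x := by
    obtain ⟨x, rfl⟩ := hf x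
    obtain ⟨y, hy⟩ := hG.divisible_mod_torsion n hn x
    exact ⟨f y, by simpa using f.isOfFinAddOrder hy⟩
  divisible_or_finite p hp := by
    refine (hG.divisible_or_finite p hp).imp (fun h x => ?_) (fun h => ?_)
    · obtain ⟨x, rfl⟩ := hf x
      obtain ⟨y, rfl⟩ := h x
      exact ⟨f y, by simp⟩
    · let g : (nsmulAddMonoidHom p : G →+ G).range →+ (nsmulAddMonoidHom p : H →+ H).range :=
        (f.comp (AddSubgroup.subtype _)).codRestrict _ (by
          rintro ⟨_, x, rfl⟩
          exact ⟨f x, (map_nsmul f p x).symm⟩)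
      refine (@finite_ker_nsmul_of_surjective _ _ _ _ g ?_ p hp.ne_zero ?_ h).1
      · rintro ⟨_, y, rfl⟩
        obtain ⟨x, rfl⟩ := hf y
        exact ⟨⟨_, x, rfl⟩, Subtype.ext (map_nsmul f p x)⟩
      · exact (LinearMap.rank_le_of_injective
          (AddSubgroup.subtype (nsmulAddMonoidHom p : G →+ G).range).toIntLinearMap
          Subtype.val_injective).trans_lt hG.rank_lt

theorem rank_ker_add_rank {G H : Type u} [AddCommGroup G] [AddCommGroup H] (f : G →+ H)
    (hf : Function.Surjective f) : Module.rank ℤ H + Module.rank ℤ f.ker = Module.rank ℤ G := by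
  have := LinearMap.rank_range_add_rank_ker f.toIntLinearMap
  rwa [LinearMap.range_eq_top.2 hf, rank_top] at this

theorem torsion_of_rank_eq_zero {G : Type*} [AddCommGroup G] (h : Module.rank ℤ G = 0) (x : G) :
    ∃ n : ℕ, n ≠ 0 ∧ n • x = 0 := by
  obtain ⟨a, ha, hx⟩ := rank_eq_zero_iff.1 h x
  exact ⟨a.natAbs, by simpa using ha, natAbs_nsmul_eq_zero.2 hx⟩

/-- Comparing finite ranks shows that N and the cokernel of φ are torsion, which reduces the
splitting to the p-components P and R. -/
theorem IsNearlyDivisible.isGeneralizedCoBassian {H : Type u} [AddCommGroup H]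
    (hH : IsNearlyDivisible H) : IsGeneralizedCoBassian H := by
  intro N φ hφ
  let π := QuotientAddGroup.mk' N
  have hπ : Function.Surjective π := QuotientAddGroup.mk'_surjective N
  have hN : Module.rank ℤ π.ker = 0 := by
    have h1 := rank_ker_add_rank π hπ
    have h2 : Module.rank ℤ H ≤ Module.rank ℤ (H ⧸ N) :=
      LinearMap.rank_le_of_injective φ.toIntLinearMap hφ
    have h3 : Module.rank ℤ (H ⧸ N) < Cardinal.aleph0 := (h1 ▸ self_le_add_right _ _).trans_lt hH.rank_lt
    have h4 : Module.rank ℤ π.ker + Module.rank ℤ (H ⧸ N) ≤ 0 + Module.rank ℤ (H ⧸ N) := by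
      rw [add_comm, h1, zero_add]; exact h2
    simpa using (Cardinal.add_le_add_iff_of_lt_aleph0 h3).1 h4
  have hQ : Module.rank ℤ ((H ⧸ N) ⧸ φ.range) = 0 := by
    have h1 := rank_ker_add_rank (QuotientAddGroup.mk' φ.range)
      (QuotientAddGroup.mk'_surjective φ.range)
    rw [QuotientAddGroup.ker_mk'] at h1
    have h0 := rank_ker_add_rank π hπ
    rw [hN, add_zero] at h0
    have h2 : Module.rank ℤ φ.range = Module.rank ℤ H :=
      (AddMonoidHom.ofInjective hφ).toIntLinearEquiv.symm.rank_eq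
    rw [h2, h0] at h1
    have h4 : Module.rank ℤ ((H ⧸ N) ⧸ φ.range) + Module.rank ℤ H ≤ 0 + Module.rank ℤ H := by
      rw [h1, zero_add]
    simpa using (Cardinal.add_le_add_iff_of_lt_aleph0 hH.rank_lt).1 h4
  refine isDirectSummand_of_primary φ.range (fun y => ?_) (fun p hp => ?_)
  · obtain ⟨n, hn, h⟩ := torsion_of_rank_eq_zero hQ (QuotientAddGroup.mk' φ.range y)
    exact ⟨n, hn, (QuotientAddGroup.eq_zero_iff _).1 (by simpa using h)⟩
  have : Fact p.Prime := ⟨hp⟩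
  let P := AddCommGroup.primaryComponent H p
  let R := AddCommGroup.primaryComponent (H ⧸ N) p
  have hP : ∀ x : P, ∃ k : ℕ, p ^ k • x = 0 := fun ⟨x, k, hk⟩ => ⟨k, Subtype.ext hk⟩
  have hres : ∀ (g : H →+ H ⧸ N) (x : P), g x ∈ R := by
    rintro g ⟨x, k, hk⟩
    exact ⟨k, by rw [← map_nsmul, hk, map_zero]⟩
  let res : (H →+ H ⧸ N) → (P →+ R) := fun g => (g.comp P.subtype).codRestrict R (hres g)
  have hφP : Function.Injective (res φ) := fun a b hab =>
    Subtype.ext (hφ (congrArg (fun z : R => (z : H ⧸ N)) hab))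
  have hπP : Function.Surjective (res π) := by
    rintro ⟨y, k, hk⟩
    obtain ⟨x, rfl⟩ := hπ y
    obtain ⟨n, hn, hx⟩ := torsion_of_rank_eq_zero hN
      ⟨p ^ k • x, by rw [AddMonoidHom.mem_ker, map_nsmul]; exact hk⟩
    have hx' : n • p ^ k • x = 0 := congrArg Subtype.val hx
    have hfin : IsOfFinAddOrder x := isOfFinAddOrder_iff_nsmul_eq_zero.2
      ⟨n * p ^ k, Nat.pos_of_ne_zero (mul_ne_zero hn (pow_ne_zero _ hp.ne_zero)),
        by rw [mul_smul, hx']⟩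
    -- Subtracting p^k u x makes x p-primary without changing its image, which p^k kills.
    obtain ⟨u, j, hj⟩ := exists_sub_smul_primary_of_isOfFinAddOrder hp hfin k
    refine ⟨⟨_, j, hj⟩, Subtype.ext ?_⟩
    change π (x - p ^ k • u • x) = π x
    rw [map_sub, map_nsmul, map_zsmul, smul_comm, show p ^ k • π x = 0 from hk, smul_zero,
      sub_zero]
  have hsplit : IsDirectSummand (res φ).range := by
    rcases hH.divisible_or_finite p hp with hdiv | hfin
    · refine IsDivisible.isDirectSummand_range (isDivisible_of_pGroup hp hP ?_) _ hφP
      rintro ⟨x, k, hk⟩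
      obtain ⟨y, rfl⟩ := hdiv x
      exact ⟨⟨y, k + 1, by rw [pow_succ, mul_smul, hk]⟩, rfl⟩
    · refine isDirectSummand_range_of_pGroup hP ?_ (res π) hπP _ hφP
      let g : (nsmulAddMonoidHom p : P →+ P).range → (nsmulAddMonoidHom p : H →+ H).range :=
        fun x => ⟨((x : P) : H), by
          obtain ⟨_, x, rfl⟩ := x
          exact ⟨x, rfl⟩⟩
      have hg : Function.Injective g := fun a b hab =>
        Subtype.ext (Subtype.ext (congrArg (fun z : (nsmulAddMonoidHom p : H →+ H).range => (z : H)) hab))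
      refine Finite.of_injective (fun x => (⟨g x, Subtype.ext ?_⟩ :
        (nsmulAddMonoidHom p : (nsmulAddMonoidHom p : H →+ H).range →+ _).ker)) ?_
      · have : p • (x : (nsmulAddMonoidHom p : P →+ P).range) = 0 := x.2
        exact congrArg (fun z : (nsmulAddMonoidHom p : P →+ P).range => ((z : P) : H)) this
      · intro a b hab
        exact Subtype.ext (hg (congrArg Subtype.val hab))
  obtain ⟨S, hS⟩ := hsplit
  refine ⟨S.map R.subtype, ?_, ?_, ?_⟩
  · rintro _ ⟨⟨x, hx⟩, _, rfl⟩
    exact hx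
  · rw [AddSubgroup.disjoint_def]
    rintro _ ⟨s, hs, rfl⟩ ⟨x, hx⟩
    obtain ⟨k, hk⟩ := s.2
    have hxP : x ∈ P := ⟨k, hφ (by rw [map_nsmul, hx, map_zero]; exact hk)⟩
    have := AddSubgroup.disjoint_def.1 hS.disjoint (x := s) ⟨⟨x, hxP⟩, Subtype.ext hx⟩ hs
    simp [this]
  · rintro y k ⟨h, hy⟩
    -- If h were p^k a, then y - φ(a) would be p-primary. Since h is only p^k a up to torsion, the
    -- correction b absorbs the part of the error that is not p-primary.
    obtain ⟨a, ha⟩ := hH.divisible_mod_torsion (p ^ k) (pow_ne_zero _ hp.ne_zero) h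
    obtain ⟨u, j, hj⟩ := exists_sub_smul_primary_of_isOfFinAddOrder hp ha k
    set b := u • (p ^ k • a - h)
    have hyR : y - φ (a - b) ∈ R := by
      refine ⟨j + k, ?_⟩
      have : p ^ k • (y - φ (a - b)) = - φ (p ^ k • a - h - p ^ k • b) := by
        simp only [smul_sub, map_sub, map_nsmul, ← hy]; abel
      rw [pow_add, mul_smul, this, smul_neg, ← map_nsmul, hj, map_zero, neg_zero]
    have : (⟨_, hyR⟩ : R) ∈ (res φ).range ⊔ S := by rw [hS.sup_eq_top]; trivial
    obtain ⟨_, ⟨c, rfl⟩, s, hs, hcs⟩ := AddSubgroup.mem_sup.1 this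
    refine AddSubgroup.mem_sup.2 ⟨φ (a - b + c), ⟨_, rfl⟩, s, ⟨s, hs, rfl⟩, ?_⟩
    have : φ c + s = y - φ (a - b) := congrArg (fun v : R => (v : H ⧸ N)) hcs
    rw [map_add, add_assoc, this]; abel

/-! ### The obstruction to being generalized co-Hopfian. -/

theorem IsDirectSummand.map_equiv {A B : Type*} [AddCommGroup A] [AddCommGroup B] (e : A ≃+ B)
    {R : AddSubgroup A} (h : IsDirectSummand R) : IsDirectSummand (R.map e.toAddMonoidHom) := by
  obtain ⟨C, hC⟩ := h
  exact ⟨C.map e.toAddMonoidHom, e.mapAddSubgroup.isCompl_iff.1 hC⟩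

theorem IsGeneralizedCoHopfian.of_equiv {A B : Type*} [AddCommGroup A] [AddCommGroup B]
    (e : A ≃+ B) (h : IsGeneralizedCoHopfian A) : IsGeneralizedCoHopfian B := by
  intro φ hφ
  have := (h ((e.symm.toAddMonoidHom.comp φ).comp e.toAddMonoidHom)
    (e.symm.injective.comp (hφ.comp e.injective))).map_equiv e
  convert this using 1
  ext y
  constructor
  · rintro ⟨x, rfl⟩
    exact ⟨_, ⟨e.symm x, rfl⟩, by simp⟩
  · rintro ⟨_, ⟨x, rfl⟩, rfl⟩
    exact ⟨e x, by simp⟩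

/-- The definition only tests images in the universe of G. Passing through the quotient by the
kernel admits test groups from any universe. -/
theorem IsSuperGeneralizedCoHopfian.of_surjective {G : Type*} [AddCommGroup G]
    (hG : IsSuperGeneralizedCoHopfian G) {A : Type*} [AddCommGroup A] (f : G →+ A)
    (hf : Function.Surjective f) : IsGeneralizedCoHopfian A :=
  (hG (G ⧸ f.ker) (QuotientAddGroup.mk' _) (QuotientAddGroup.mk'_surjective _)).of_equiv
    (QuotientAddGroup.quotientKerEquivOfSurjective f hf)

/-- The map (z, v) ↦ (0, ψ(z) e₀ + shift v) with ψ(1) = pb is injective. It sends (1, 0) to p(b e₀),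
although (1, 0) is not a multiple of p. Its image is thus not pure, whereas summands are. -/
theorem not_isGeneralizedCoHopfian_zmod_prod_finsupp {p : ℕ} (hp : p.Prime) {B : Type*}
    [AddCommGroup B] (b : B) (hb : p • b ≠ 0) (hb' : p • p • b = 0) :
    ¬ IsGeneralizedCoHopfian (ZMod p × (ℕ →₀ B)) := by
  intro h
  have : Fact p.Prime := ⟨hp⟩
  let ψ : ZMod p →+ B := ZMod.lift p ⟨zmultiplesHom B (p • b), by simpa using hb'⟩
  have hψ1 : ψ 1 = p • b := by
    have := ZMod.lift_coe p (⟨zmultiplesHom B (p • b), by simpa using hb'⟩ :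
      {f : ℤ →+ B // f p = 0}) 1
    simpa using this
  have hψ : Function.Injective ψ := by
    rw [injective_iff_map_eq_zero]
    intro z hz
    by_contra hz0
    apply hb
    rw [← hψ1, ← mul_inv_cancel₀ hz0, ← ZMod.natCast_zmod_val z⁻¹, mul_comm, ← nsmul_eq_mul,
      map_nsmul, hz, smul_zero]
  let φ : ZMod p × (ℕ →₀ B) →+ ZMod p × (ℕ →₀ B) :=
    (AddMonoidHom.inr _ _).comp (((Finsupp.singleAddHom 0).comp ψ).coprod
      (Finsupp.mapDomain.addMonoidHom Nat.succ))
  have hφa : ∀ z v, φ (z, v) = (0, Finsupp.single 0 (ψ z) + Finsupp.mapDomain Nat.succ v) :=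
    fun z v => rfl
  have hφ : Function.Injective φ := by
    rw [injective_iff_map_eq_zero]
    rintro ⟨z, v⟩ hzv
    rw [hφa] at hzv
    have h2 : Finsupp.single 0 (ψ z) + Finsupp.mapDomain Nat.succ v = 0 := congrArg Prod.snd hzv
    have h0 : ψ z = 0 := by
      have := DFunLike.congr_fun h2 0
      rw [Finsupp.add_apply, Finsupp.mapDomain_of_notMem_range _ _ (by simp)] at this
      simpa using this
    have hz : z = 0 := hψ (by simpa using h0)
    rw [h0, Finsupp.single_zero, zero_add] at h2
    have hv : v = 0 := Finsupp.mapDomain_injective Nat.succ_injective (by simpa using h2)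
    rw [hz, hv]; rfl
  obtain ⟨C, hC⟩ := h φ hφ
  have he : ((0, Finsupp.single 0 b) : ZMod p × (ℕ →₀ B)) ∈ φ.range ⊔ C := by
    rw [hC.sup_eq_top]; trivial
  obtain ⟨_, ⟨x, rfl⟩, c, hc, hxc⟩ := AddSubgroup.mem_sup.1 he
  have h1 : φ (1, 0) = p • φ x + p • c := by
    rw [← smul_add, hxc, hφa, hψ1]
    simp
  have hpc : p • c = 0 := by
    refine AddSubgroup.disjoint_def.1 hC.disjoint ?_ (nsmul_mem hc p)
    exact ⟨(1, 0) - p • x, by rw [map_sub, map_nsmul, h1]; abel⟩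
  rw [hpc, add_zero, ← map_nsmul] at h1
  have := congrArg Prod.fst (hφ h1)
  simp at this

theorem exists_surjective_of_ne_zero {p : ℕ} [Fact p.Prime] {V : Type*} [AddCommGroup V]
    [Module (ZMod p) V] (x : V) (hx : x ≠ 0) : ∃ f : V →+ ZMod p, Function.Surjective f := by
  obtain ⟨f, hf⟩ : ∃ f : V →ₗ[ZMod p] ZMod p, f x ≠ 0 := by
    by_contra! h
    exact hx ((Module.forall_dual_apply_eq_zero_iff (ZMod p) x).1 h)
  exact ⟨f.toAddMonoidHom, LinearMap.surjective (f := f) (fun h => hf (by rw [h]; rfl))⟩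

/-- A group that is not `p`-divisible maps onto `ZMod p`. -/
theorem exists_surjective_zmod {G : Type*} [AddCommGroup G] {p : ℕ} (hp : p.Prime) (x : G)
    (hx : ∀ y : G, p • y ≠ x) : ∃ χ : G →+ ZMod p, Function.Surjective χ := by
  have : Fact p.Prime := ⟨hp⟩
  let V := G ⧸ (nsmulAddMonoidHom p : G →+ G).range
  let _ : Module (ZMod p) V := AddCommGroup.zmodModule (by
    intro v
    obtain ⟨y, rfl⟩ := QuotientAddGroup.mk'_surjective _ v
    rw [← map_nsmul]
    exact (QuotientAddGroup.eq_zero_iff _).2 ⟨y, rfl⟩)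
  let π := QuotientAddGroup.mk' (nsmulAddMonoidHom p : G →+ G).range
  have hπx : π x ≠ 0 := by
    intro h
    obtain ⟨y, hy⟩ := (QuotientAddGroup.eq_zero_iff _).1 h
    exact hx y hy
  obtain ⟨f, hf⟩ := exists_surjective_of_ne_zero (p := p) (π x) hπx
  exact ⟨f.comp π, hf.comp (QuotientAddGroup.mk'_surjective _)⟩

/-- The second coordinate can be corrected by adding a multiple of p, which the character to `ZMod
p` does not see. -/
theorem exists_surjective_zmod_prod {G D : Type*} [AddCommGroup G] [AddCommGroup D] {p : ℕ}
    (hp : p.Prime) (x : G) (hx : ∀ y : G, p • y ≠ x) (hD : IsDivisible D) (f : G →+ D)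
    (hf : Function.Surjective f) : ∃ g : G →+ ZMod p × D, Function.Surjective g := by
  obtain ⟨χ, hχ⟩ := exists_surjective_zmod hp x hx
  refine ⟨χ.prod f, ?_⟩
  rintro ⟨z, d⟩
  obtain ⟨a, rfl⟩ := hχ z
  obtain ⟨d', hd'⟩ := hD p (by exact_mod_cast hp.ne_zero) (d - f a)
  obtain ⟨c, rfl⟩ := hf d'
  refine ⟨a + p • c, Prod.ext ?_ ?_⟩
  · simp
  · rw [natCast_zsmul] at hd'
    simp [hd']

/-! ### Prüfer groups and their direct sums. -/

/-- The Prüfer `p`-group. -/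
abbrev Prufer (p : ℕ) [Fact p.Prime] : Type :=
  AddCommGroup.primaryComponent (ℚ ⧸ AddSubgroup.zmultiples (1 : ℚ)) p

theorem Prufer.primary {p : ℕ} [Fact p.Prime] (x : Prufer p) : ∃ k : ℕ, p ^ k • x = 0 := by
  obtain ⟨x, k, hk⟩ := x
  exact ⟨k, Subtype.ext hk⟩

instance Prufer.countable (p : ℕ) [Fact p.Prime] : Countable (Prufer p) :=
  have : Countable (ℚ ⧸ AddSubgroup.zmultiples (1 : ℚ)) :=
    (QuotientAddGroup.mk'_surjective (AddSubgroup.zmultiples (1 : ℚ))).countable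
  inferInstance

theorem Prufer.isDivisible (p : ℕ) [Fact p.Prime] : IsDivisible (Prufer p) := by
  have hp : p.Prime := Fact.out
  refine isDivisible_of_pGroup hp Prufer.primary ?_
  rintro ⟨x, k, hk⟩
  obtain ⟨q, rfl⟩ := QuotientAddGroup.mk'_surjective _ x
  have h : p • (QuotientAddGroup.mk' (AddSubgroup.zmultiples (1 : ℚ)) (q / p)) =
      QuotientAddGroup.mk' _ q := by
    rw [← map_nsmul, nsmul_eq_mul, mul_div_cancel₀ _ (by exact_mod_cast hp.ne_zero)]
  exact ⟨⟨_, k + 1, by rw [pow_succ, mul_smul, h, hk]⟩, Subtype.ext h⟩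

theorem Prufer.exists_order_sq (p : ℕ) [Fact p.Prime] :
    ∃ b : Prufer p, p • b ≠ 0 ∧ p • p • b = 0 := by
  have hp : p.Prime := Fact.out
  have hp0 : (p : ℚ) ≠ 0 := by exact_mod_cast hp.ne_zero
  let π := QuotientAddGroup.mk' (AddSubgroup.zmultiples (1 : ℚ))
  have h1 : p • π (1 / p / p) = π (1 / p) := by
    rw [← map_nsmul, nsmul_eq_mul, mul_div_cancel₀ _ hp0]
  have h2 : p • p • π (1 / p / p) = 0 := by
    rw [h1, ← map_nsmul, nsmul_eq_mul, mul_div_cancel₀ _ hp0]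
    exact (QuotientAddGroup.eq_zero_iff _).2 (AddSubgroup.mem_zmultiples _)
  refine ⟨⟨π (1 / p / p), 2, by rw [pow_two, mul_smul, h2]⟩, ?_, Subtype.ext h2⟩
  intro h
  have h3 : π (1 / p) = 0 := h1.symm.trans (congrArg Subtype.val h)
  obtain ⟨n, hn⟩ := AddSubgroup.mem_zmultiples_iff.1 ((QuotientAddGroup.eq_zero_iff _).1 h3)
  have h4 : (n : ℚ) * p = 1 := by
    rw [zsmul_eq_mul, mul_one] at hn
    rw [hn, one_div, inv_mul_cancel₀ hp0]
  have h5 : n * (p : ℤ) = 1 := by exact_mod_cast h4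
  exact hp.one_lt.ne' (by simpa using Int.isUnit_iff_natAbs_eq.1 (IsUnit.of_mul_eq_one_right _ h5))

theorem IsDivisible.finsupp {D : Type*} [AddCommGroup D] (hD : IsDivisible D) (ι : Type*) :
    IsDivisible (ι →₀ D) := by
  intro n hn v
  induction v using Finsupp.induction_linear with
  | zero => exact ⟨0, smul_zero _⟩
  | add v w hv hw =>
    obtain ⟨v, rfl⟩ := hv
    obtain ⟨w, rfl⟩ := hw
    exact ⟨v + w, smul_add _ _ _⟩
  | single i d =>
    obtain ⟨d, rfl⟩ := hD n hn d
    exact ⟨Finsupp.single i d, Finsupp.smul_single _ _ _⟩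

theorem primary_finsupp {P : Type*} [AddCommGroup P] {p : ℕ} (hP : ∀ x : P, ∃ k : ℕ, p ^ k • x = 0)
    (ι : Type*) (v : ι →₀ P) : ∃ k : ℕ, p ^ k • v = 0 := by
  induction v using Finsupp.induction_linear with
  | zero => exact ⟨0, smul_zero _⟩
  | add v w hv hw =>
    obtain ⟨j, hj⟩ := hv
    obtain ⟨k, hk⟩ := hw
    exact ⟨j + k, by rw [smul_add, pow_add, mul_smul _ _ w, hk, mul_comm, mul_smul, hj]; simp⟩
  | single i d =>
    obtain ⟨k, hk⟩ := hP d
    exact ⟨k, by rw [Finsupp.smul_single, hk, Finsupp.single_zero]⟩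

/-- Otherwise G would map onto ZMod p ⊕ Prüfer^(ℕ), which is an instance of the obstruction. -/
theorem IsSuperGeneralizedCoHopfian.exists_nsmul_eq_of_surjective {G : Type*} [AddCommGroup G]
    (hG : IsSuperGeneralizedCoHopfian G) {p : ℕ} [Fact p.Prime] (f : G →+ (ℕ →₀ Prufer p))
    (hf : Function.Surjective f) (x : G) : ∃ y : G, p • y = x := by
  by_contra! hx
  obtain ⟨g, hg⟩ := exists_surjective_zmod_prod Fact.out x hx ((Prufer.isDivisible p).finsupp ℕ) f hf
  obtain ⟨b, hb, hb'⟩ := Prufer.exists_order_sq p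
  exact not_isGeneralizedCoHopfian_zmod_prod_finsupp Fact.out b hb hb' (hG.of_surjective g hg)

/-! ### Constructing surjections onto the test groups. -/

/-- A free subgroup of countably infinite rank maps onto D, and the map extends to G because D is
injective. -/
theorem exists_surjective_of_aleph0_le_rank {G D : Type*} [AddCommGroup G] [AddCommGroup D]
    [Countable D] (hD : IsDivisible D) (hG : Cardinal.aleph0 ≤ Module.rank ℤ G) :
    ∃ f : G →+ D, Function.Surjective f := by
  obtain ⟨s, hs, hli⟩ := exists_set_linearIndependent_of_isDomain ℤ G
  have : Infinite s := Cardinal.infinite_iff.2 (hs ▸ hG)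
  have hv := hli.linearIndependent.comp _ (Infinite.natEmbedding s).injective
  obtain ⟨d, hd⟩ := exists_surjective_nat D
  obtain ⟨f, hf⟩ := hD.exists_extension (A := ℕ →₀ ℤ)
    (Finsupp.linearCombination ℤ ((fun x : s => id (x : G)) ∘ Infinite.natEmbedding s)).toAddMonoidHom
    (linearIndependent_iff_injective_finsuppLinearCombination.1 hv)
    (Finsupp.linearCombination ℤ d).toAddMonoidHom
  refine ⟨f, fun y => ?_⟩
  obtain ⟨n, rfl⟩ := hd y
  refine ⟨_, (hf (Finsupp.single n 1)).trans ?_⟩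
  simp

theorem exists_surjective_factor {X Y Z : Type*} [AddCommGroup X] [AddCommGroup Y] [AddCommGroup Z]
    (f : X →+ Y) (hf : Function.Surjective f) (g : X →+ Z) (hg : Function.Surjective g)
    (h : ∀ x, f x = 0 → g x = 0) : ∃ k : Y →+ Z, Function.Surjective k := by
  let e := QuotientAddGroup.quotientKerEquivOfSurjective f hf
  have hl : Function.Surjective (QuotientAddGroup.lift f.ker g h) := fun z => by
    obtain ⟨x, rfl⟩ := hg z
    exact ⟨QuotientAddGroup.mk x, rfl⟩
  exact ⟨(QuotientAddGroup.lift f.ker g h).comp (e.symm : Y →+ X ⧸ f.ker),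
    hl.comp e.symm.surjective⟩

/-- Integer coefficients are used because basis vectors will be lifted to a group that p need not
kill. -/
theorem dvd_of_linearCombination_eq_zero {p : ℕ} {J U : Type*} [AddCommGroup U]
    [Module (ZMod p) U] {u : J → U} (hu : LinearIndependent (ZMod p) u) (c : J →₀ ℤ)
    (hc : Finsupp.linearCombination ℤ u c = 0) (j : J) : (p : ℤ) ∣ c j := by
  rw [← ZMod.intCast_zmod_eq_zero_iff_dvd]
  by_cases hj : j ∈ c.support
  · refine linearIndependent_iff'.1 hu c.support (fun j => (c j : ZMod p)) ?_ j hj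
    simpa [Finsupp.linearCombination_apply, Finsupp.sum, Int.cast_smul_eq_zsmul] using hc
  · simp [Finsupp.notMem_support_iff.1 hj]

theorem exists_linearCombination_eq {p : ℕ} {J U : Type*} [AddCommGroup U]
    [Module (ZMod p) U] (u : Module.Basis J (ZMod p) U) (x : U) :
    ∃ c : J →₀ ℤ, Finsupp.linearCombination ℤ u c = x := by
  refine ⟨(u.repr x).mapRange (fun z => (z.cast : ℤ)) (by simp), ?_⟩
  conv_rhs => rw [← u.linearCombination_repr x]
  rw [Finsupp.linearCombination_apply, Finsupp.linearCombination_apply,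
    Finsupp.sum_mapRange_index (by simp)]
  refine Finsupp.sum_congr fun j _ => ?_
  rw [← Int.cast_smul_eq_zsmul (ZMod p), ZMod.intCast_zmod_cast]

/-- An infinite elementary `p`-group has an infinite basis. -/
theorem exists_infinite_basis {p : ℕ} [Fact p.Prime] {U : Type u} [AddCommGroup U] [Infinite U]
    [Module (ZMod p) U] : ∃ (J : Type u) (_ : Infinite J) (u : J → U),
      (∀ c : J →₀ ℤ, Finsupp.linearCombination ℤ u c = 0 → ∀ j, (p : ℤ) ∣ c j) ∧
      ∀ x : U, ∃ c : J →₀ ℤ, Finsupp.linearCombination ℤ u c = x := by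
  let b := Module.Basis.ofVectorSpace (ZMod p) U
  have hJ : Infinite (Module.Basis.ofVectorSpaceIndex (ZMod p) U) := by
    by_contra h
    rw [not_infinite_iff_finite] at h
    have := Module.Finite.of_basis b
    have : Finite U := Module.finite_of_finite (ZMod p)
    exact not_finite U
  exact ⟨_, hJ, b, dvd_of_linearCombination_eq_zero b.linearIndependent,
    exists_linearCombination_eq b⟩

theorem exists_surjective_of_infinite {p : ℕ} [Fact p.Prime] {V W : Type*} [AddCommGroup V]
    [AddCommGroup W] [Infinite V] [Countable W] (hV : ∀ x : V, p • x = 0)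
    (hW : ∀ x : W, p • x = 0) : ∃ f : V →+ W, Function.Surjective f := by
  let _ : Module (ZMod p) V := AddCommGroup.zmodModule hV
  obtain ⟨J, _, u, hu, hu'⟩ := exists_infinite_basis (p := p) (U := V)
  obtain ⟨d, hd⟩ := exists_surjective_nat W
  have hs := Function.invFun_surjective (Infinite.natEmbedding J).injective
  let g : J → W := d ∘ Function.invFun (Infinite.natEmbedding J)
  refine exists_surjective_factor (Finsupp.linearCombination ℤ u).toAddMonoidHom hu'
    (Finsupp.linearCombination ℤ g).toAddMonoidHom ?_ ?_
  · intro y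
    obtain ⟨j, rfl⟩ := (hd.comp hs) y
    exact ⟨Finsupp.single j 1, by simp [g]⟩
  · intro c hc
    change Finsupp.linearCombination ℤ g c = 0
    rw [Finsupp.linearCombination_apply]
    refine Finset.sum_eq_zero fun j _ => ?_
    obtain ⟨m, hm⟩ := hu c hc j
    change c j • g j = 0
    rw [hm, mul_smul, natCast_zsmul, hW]

/-- A `p`-divisible subgroup with infinite `p`-torsion allows one to map onto any countable
divisible `p`-group. -/
theorem exists_surjective_of_infinite_ker_nsmul {p : ℕ} [Fact p.Prime] {G A D : Type*}
    [AddCommGroup G] [AddCommGroup A] [AddCommGroup D] [Countable D] (hD : IsDivisible D)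
    (hDp : ∀ x : D, ∃ k : ℕ, p ^ k • x = 0) (i : A →+ G) (hi : Function.Injective i)
    (hA : ∀ x : A, ∃ y : A, p • y = x) [Infinite (nsmulAddMonoidHom p : A →+ A).ker] :
    ∃ f : G →+ D, Function.Surjective f := by
  obtain ⟨g, hg⟩ := exists_surjective_of_infinite (p := p)
    (V := (nsmulAddMonoidHom p : A →+ A).ker) (W := (nsmulAddMonoidHom p : D →+ D).ker)
    (fun x => Subtype.ext x.2) (fun x => Subtype.ext x.2)
  obtain ⟨f, hf⟩ := hD.exists_extension (i.comp (AddSubgroup.subtype _))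
    (hi.comp Subtype.val_injective) ((AddSubgroup.subtype _).comp g)
  refine ⟨f, ?_⟩
  -- f already maps A[p] onto D[p]. To reach d, reach pd first, divide the preimage by p inside A,
  -- and correct by an element of A[p].
  have key : ∀ (k : ℕ) (d : D), p ^ k • d = 0 → ∃ a : A, f (i a) = d := by
    intro k
    induction k with
    | zero => exact fun d hd => ⟨0, by simpa using hd.symm⟩
    | succ k ih =>
      intro d hd
      obtain ⟨a, ha⟩ := ih (p • d) (by rw [← mul_smul, ← pow_succ, hd])
      obtain ⟨c, rfl⟩ := hA a
      have h0 : p • (d - f (i c)) = 0 := by rw [smul_sub, ← ha, map_nsmul, map_nsmul, sub_self]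
      obtain ⟨e, he⟩ := hg ⟨_, h0⟩
      refine ⟨c + e, ?_⟩
      have h1 : f (i e) = d - f (i c) := (hf e).trans (congrArg Subtype.val he)
      rw [map_add, map_add, h1]; abel
  intro d
  obtain ⟨k, hk⟩ := hDp d
  obtain ⟨a, ha⟩ := key k d hk
  exact ⟨i a, ha⟩

theorem finite_of_finite_ker_of_finite_range {A B : Type*} [AddCommGroup A] [AddCommGroup B]
    (f : A →+ B) [Finite f.ker] [Finite f.range] : Finite A := by
  refine Nat.finite_of_card_ne_zero (α := A) ?_
  rw [← f.ker.card_mul_index, AddSubgroup.index_ker]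
  exact mul_ne_zero Nat.card_pos.ne' Nat.card_pos.ne'

/-- A `p`-group with infinite `p`-torsion and finite quotient modulo `p` contains a
`p`-divisible subgroup with infinite `p`-torsion. -/
theorem exists_divisible_subgroup_of_finite_index {p : ℕ} (hp : p.Prime) {A : Type*}
    [AddCommGroup A] (hA : ∀ x : A, ∃ k : ℕ, p ^ k • x = 0)
    (hfin : (nsmulAddMonoidHom p : A →+ A).range.index ≠ 0)
    (hinf : Infinite (nsmulAddMonoidHom p : A →+ A).ker) :
    ∃ D : AddSubgroup A, (∀ x : D, ∃ y : D, p • y = x) ∧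
      Infinite (nsmulAddMonoidHom p : D →+ D).ker := by
  have : Finite (A ⧸ (nsmulAddMonoidHom p : A →+ A).range) := Nat.finite_of_card_ne_zero hfin
  -- Coset representatives generate a finite E with A = E + pA. If p^n kills E, then p^n A = p^(n+1)
  -- A is p-divisible. It has finite index because A = E + p^n A, so its socle stays infinite.
  let E : AddSubgroup A := AddSubgroup.closure
    (Set.range (Quotient.out : A ⧸ (nsmulAddMonoidHom p : A →+ A).range → A))
  have : AddGroup.FG E := (AddGroup.fg_iff_addSubgroup_fg E).2
    ((AddSubgroup.fg_iff _).2 ⟨_, rfl, Set.finite_range _⟩)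
  have : Finite E := AddCommGroup.finite_of_fg_isAddTorsion E (by
    rintro ⟨x, hx⟩
    obtain ⟨k, hk⟩ := hA x
    exact isOfFinAddOrder_iff_nsmul_eq_zero.2 ⟨p ^ k, pow_pos hp.pos k, Subtype.ext hk⟩)
  obtain ⟨n, hn⟩ : ∃ n : ℕ, ∀ x ∈ E, p ^ n • x = 0 := by
    choose k hk using hA
    obtain ⟨n, hn⟩ := (Set.finite_range (fun x : E => k x)).bddAbove
    refine ⟨n, fun x hx => ?_⟩
    obtain ⟨m, hm⟩ := Nat.exists_eq_add_of_le (hn ⟨⟨x, hx⟩, rfl⟩ : k x ≤ n)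
    rw [hm, pow_add, mul_comm, mul_smul, hk, smul_zero]
  have hE1 : ∀ x : A, ∃ e ∈ E, ∃ y, x = e + p • y := by
    intro x
    let q : A ⧸ (nsmulAddMonoidHom p : A →+ A).range := QuotientAddGroup.mk x
    obtain ⟨y, hy⟩ : - q.out + x ∈ (nsmulAddMonoidHom p : A →+ A).range :=
      QuotientAddGroup.eq.1 (QuotientAddGroup.out_eq' q)
    have hy' : p • y = - q.out + x := hy
    exact ⟨q.out, AddSubgroup.subset_closure ⟨q, rfl⟩, y, by rw [hy']; abel⟩
  have hE : ∀ (m : ℕ) (x : A), ∃ e ∈ E, ∃ y, x = e + p ^ m • y := by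
    intro m
    induction m with
    | zero => exact fun x => ⟨0, zero_mem _, x, by simp⟩
    | succ m ih =>
      intro x
      obtain ⟨e, he, y, rfl⟩ := ih x
      obtain ⟨e', he', y', rfl⟩ := hE1 y
      refine ⟨e + p ^ m • e', add_mem he (nsmul_mem he' _), y', ?_⟩
      rw [smul_add, pow_succ, mul_smul]; abel
  let D := (nsmulAddMonoidHom (p ^ n) : A →+ A).range
  refine ⟨D, ?_, ?_⟩
  · rintro ⟨_, x, rfl⟩
    obtain ⟨e, he, y, rfl⟩ := hE1 x
    refine ⟨⟨_, y, rfl⟩, Subtype.ext ?_⟩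
    change p • p ^ n • y = p ^ n • (e + p • y)
    rw [smul_add, hn e he, zero_add, smul_comm]
  · by_contra h
    rw [not_infinite_iff_finite] at h
    have hAD : Finite (A ⧸ D) := by
      refine Finite.of_surjective (fun e : E => (QuotientAddGroup.mk (e : A) : A ⧸ D)) ?_
      intro q
      obtain ⟨x, rfl⟩ := QuotientAddGroup.mk_surjective q
      obtain ⟨e, he, y, rfl⟩ := hE n x
      exact ⟨⟨e, he⟩, QuotientAddGroup.eq.2 ⟨y, by simp⟩⟩
    let f : (nsmulAddMonoidHom p : A →+ A).ker →+ A ⧸ D :=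
      (QuotientAddGroup.mk' D).comp (AddSubgroup.subtype _)
    have : Finite f.ker := by
      refine Finite.of_injective (fun x => (⟨⟨((x : (nsmulAddMonoidHom p : A →+ A).ker) : A),
        (QuotientAddGroup.eq_zero_iff _).1 x.2⟩, Subtype.ext x.1.2⟩ :
          (nsmulAddMonoidHom p : D →+ D).ker)) ?_
      intro a b hab
      exact Subtype.ext (Subtype.ext
        (congrArg (fun z : (nsmulAddMonoidHom p : D →+ D).ker => ((z : D) : A)) hab))
    have := finite_of_finite_ker_of_finite_range f
    exact not_finite (nsmulAddMonoidHom p : A →+ A).ker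

/-- An abelian group `V` with `p²V = 0` and `pV` infinite maps onto
`ZMod p ⊕ (ZMod p²)^(ℕ)`. -/
theorem exists_surjective_of_infinite_range {p : ℕ} [Fact p.Prime] {V : Type*} [AddCommGroup V]
    (hV : ∀ x : V, p • p • x = 0) (hinf : Infinite (nsmulAddMonoidHom p : V →+ V).range) :
    ∃ f : V →+ ZMod p × (ℕ →₀ ZMod (p ^ 2)), Function.Surjective f := by
  let W := (nsmulAddMonoidHom p : V →+ V).ker
  let _ : Module (ZMod p) W := AddCommGroup.zmodModule fun x => Subtype.ext x.2
  have hle : (nsmulAddMonoidHom p : V →+ V).range ≤ W := by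
    rintro _ ⟨x, rfl⟩
    exact hV x
  let U : AddSubgroup W := (nsmulAddMonoidHom p : V →+ V).range.comap W.subtype
  have : Infinite U := Infinite.of_injective
    (fun x : (nsmulAddMonoidHom p : V →+ V).range => (⟨⟨x, hle x.2⟩, x.2⟩ : U))
    (fun a b hab => Subtype.ext (congrArg (fun z : U => ((z : W) : V)) hab))
  obtain ⟨K, hK⟩ := exists_isCompl_of_zmodModule (p := p) U
  let _ : Module (ZMod p) U := AddCommGroup.zmodModule fun x => Subtype.ext (Subtype.ext x.1.2)
  obtain ⟨J, _, u, hu0, hu'⟩ := exists_infinite_basis (p := p) (U := U)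
  have hlift : ∀ j, ∃ v : V, p • v = ((u j : W) : V) := fun j => (u j).2
  choose v hv using hlift
  let h : (J →₀ ℤ) →+ V := (Finsupp.linearCombination ℤ v).toAddMonoidHom
  let hu : (J →₀ ℤ) →+ U := (Finsupp.linearCombination ℤ u).toAddMonoidHom
  have hph : ∀ c, p • h c = ((hu c : W) : V) := by
    intro c
    induction c using Finsupp.induction_linear with
    | zero => simp
    | add c d hc hd => rw [map_add, smul_add, hc, hd, map_add]; rfl
    | single j n =>
      change p • Finsupp.linearCombination ℤ v (Finsupp.single j n) =
        ((Finsupp.linearCombination ℤ u (Finsupp.single j n) : U) : W)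
      rw [Finsupp.linearCombination_single, Finsupp.linearCombination_single, smul_comm, hv]
      rfl
  -- Dividing by a complement of pV in V[p] makes the lifts v_j a basis of the quotient over ℤ/p².
  let N := K.map W.subtype
  have hsurj : Function.Surjective ((QuotientAddGroup.mk' N).comp h) := by
    intro y
    obtain ⟨x, rfl⟩ := QuotientAddGroup.mk'_surjective N y
    obtain ⟨c, hc⟩ := hu' ⟨⟨p • x, hV x⟩, ⟨x, rfl⟩⟩
    have hc' : p • h c = p • x := (hph c).trans (congrArg (fun z : U => ((z : W) : V)) hc)
    have hw : p • (x - h c) = 0 := by rw [smul_sub, hc', sub_self]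
    have hmem : (⟨_, hw⟩ : W) ∈ U ⊔ K := by rw [hK.sup_eq_top]; trivial
    obtain ⟨a, ha, k, hk, hak⟩ := AddSubgroup.mem_sup.1 hmem
    obtain ⟨b, hb⟩ := hu' ⟨a, ha⟩
    have hb' : p • h b = a := (hph b).trans (congrArg (fun z : U => ((z : W) : V)) hb)
    have hak' : (a : V) + k = x - h c := congrArg (fun z : W => (z : V)) hak
    refine ⟨c + p • b, QuotientAddGroup.eq.2 ⟨k, hk, ?_⟩⟩
    change (k : V) = - h (c + p • b) + x
    rw [map_add, map_nsmul, hb', ← sub_eq_zero, eq_sub_of_add_eq' hak']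
    abel
  -- If h(c) = k lies in K, then p h(c) = 0 gives c = pb. Hence k = p h(b) lies in both U and K and
  -- vanishes, and independence, used again, makes b divisible by p.
  have hker : ∀ c, ((QuotientAddGroup.mk' N).comp h) c = 0 → ∀ j, ((p ^ 2 : ℕ) : ℤ) ∣ c j := by
    intro c hc
    obtain ⟨k, hk, hkc⟩ := (QuotientAddGroup.eq_zero_iff _).1 hc
    have hkc' : (k : V) = h c := hkc
    have h0 : hu c = 0 := by
      refine Subtype.ext (Subtype.ext ?_)
      rw [← hph, ← hkc']
      exact k.2
    have hd := hu0 c h0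
    let b : J →₀ ℤ := c.mapRange (fun n => n / p) (by simp)
    have hcb : c = p • b := by
      ext j
      simp [b, Int.mul_ediv_cancel' (hd j)]
    have hkU : k ∈ U := ⟨h b, by
      change p • h b = (k : V)
      rw [hkc', hcb, map_nsmul]⟩
    have hk0 : k = 0 := AddSubgroup.disjoint_def.1 hK.disjoint hkU hk
    have h1 : hu b = 0 := by
      refine Subtype.ext (Subtype.ext ?_)
      rw [← hph, ← map_nsmul, ← hcb, ← hkc', hk0]
      rfl
    have hd' := hu0 b h1
    intro j
    rw [hcb, Finsupp.smul_apply, nsmul_eq_mul, pow_two, Nat.cast_mul]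
    exact mul_dvd_mul_left _ (hd' j)
  -- The coordinate i 0 is reduced modulo p and the coordinates i (n + 1) modulo p²; the others are
  -- dropped.
  let i := Infinite.natEmbedding J
  let ρ : (J →₀ ℤ) →+ ZMod p × (ℕ →₀ ZMod (p ^ 2)) :=
    ((Int.castAddHom (ZMod p)).comp (Finsupp.applyAddHom (i 0))).prod
      ((Finsupp.mapRange.addMonoidHom (Int.castAddHom (ZMod (p ^ 2)))).comp
        (Finsupp.comapDomain.addMonoidHom (i.injective.comp Nat.succ_injective)))
  have hρ : Function.Surjective ρ := by
    rintro ⟨z, w⟩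
    let w' : ℕ →₀ ℤ := w.mapRange (fun x => (x.cast : ℤ)) (by simp)
    refine ⟨Finsupp.single (i 0) z.cast + Finsupp.mapDomain (i ∘ Nat.succ) w', Prod.ext ?_ ?_⟩
    · change (((Finsupp.single (i 0) z.cast + Finsupp.mapDomain (i ∘ Nat.succ) w' : J →₀ ℤ)
        (i 0) : ℤ) : ZMod p) = z
      rw [Finsupp.add_apply, Finsupp.mapDomain_of_notMem_range _ _ (by simp)]
      simp
    · ext n
      change (((Finsupp.single (i 0) z.cast + Finsupp.mapDomain (i ∘ Nat.succ) w' : J →₀ ℤ)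
        ((i ∘ Nat.succ) n) : ℤ) : ZMod (p ^ 2)) = w n
      rw [Finsupp.add_apply, Finsupp.mapDomain_apply (i.injective.comp Nat.succ_injective)]
      simp [w']
  have hρ0 : ∀ c, ((QuotientAddGroup.mk' N).comp h) c = 0 → ρ c = 0 := by
    intro c hc
    have hd := hker c hc
    refine Prod.ext ?_ ?_
    · refine (ZMod.intCast_zmod_eq_zero_iff_dvd _ _).2 (dvd_trans ?_ (hd (i 0)))
      exact_mod_cast dvd_pow_self p two_ne_zero
    · ext n
      exact (ZMod.intCast_zmod_eq_zero_iff_dvd _ _).2 (hd _)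
  obtain ⟨g, hg⟩ := exists_surjective_factor _ hsurj ρ hρ hρ0
  exact ⟨g.comp (QuotientAddGroup.mk' N), hg.comp (QuotientAddGroup.mk'_surjective N)⟩

/-! ### Passing between the group and its torsion data. -/

/-- Multiplication by n is injective, and a complement C of nF satisfies nC ⊆ nF ∩ C = 0, so C = 0.
-/
theorem IsGeneralizedCoHopfian.isDivisible {F : Type*} [AddCommGroup F] [IsAddTorsionFree F]
    (h : IsGeneralizedCoHopfian F) : IsDivisible F := by
  intro n hn x
  obtain ⟨C, hC⟩ := h (zsmulAddGroupHom n) (zsmul_right_injective hn)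
  have hx : x ∈ (zsmulAddGroupHom n : F →+ F).range ⊔ C := by rw [hC.sup_eq_top]; trivial
  obtain ⟨_, ⟨y, rfl⟩, c, hc, rfl⟩ := AddSubgroup.mem_sup.1 hx
  have h0 : n • c = 0 := AddSubgroup.disjoint_def.1 hC.disjoint ⟨c, rfl⟩ (zsmul_mem hc n)
  have : c = 0 := zsmul_right_injective hn (by simpa using h0)
  exact ⟨y, by simp [this]⟩

instance isAddTorsionFree_quotient_torsion (G : Type*) [AddCommGroup G] :
    IsAddTorsionFree (G ⧸ AddCommGroup.torsion G) := by
  rw [isAddTorsionFree_iff_not_isOfFinAddOrder]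
  intro a ha hfin
  obtain ⟨x, rfl⟩ := QuotientAddGroup.mk'_surjective _ a
  apply ha
  obtain ⟨n, hn, h⟩ := isOfFinAddOrder_iff_nsmul_eq_zero.1 hfin
  rw [← map_nsmul] at h
  obtain ⟨m, hm, h'⟩ := isOfFinAddOrder_iff_nsmul_eq_zero.1 ((QuotientAddGroup.eq_zero_iff _).1 h)
  refine (QuotientAddGroup.eq_zero_iff _).2 (isOfFinAddOrder_iff_nsmul_eq_zero.2
    ⟨m * n, Nat.mul_pos hm hn, ?_⟩)
  rw [mul_smul, h']

theorem pRank_lt_aleph0_iff {p : ℕ} [Fact p.Prime] {A : Type u} [AddCommGroup A] :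
    pRank p A < Cardinal.aleph0 ↔ Finite (nsmulAddMonoidHom p : A →+ A).ker := by
  let _ : Module (ZMod p) (AddSubgroup.torsionBy A (p : ℤ)) := AddSubgroup.torsionBy.zmodModule
  have h1 : pRank p A < Cardinal.aleph0 ↔ Finite (AddSubgroup.torsionBy A (p : ℤ)) := by
    change Module.rank (ZMod p) (AddSubgroup.torsionBy A (p : ℤ)) < _ ↔ _
    rw [Module.rank_lt_aleph0_iff]
    exact ⟨fun _ => Module.finite_of_finite (ZMod p), fun _ => inferInstance⟩
  rw [h1]
  have h2 : AddSubgroup.torsionBy A (p : ℤ) = (nsmulAddMonoidHom p : A →+ A).ker := by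
    ext x
    change (p : ℤ) • x = 0 ↔ p • x = 0
    rw [natCast_zsmul]
  rw [h2]

/-- Dividing x by p modulo torsion leaves an error whose p-primary part is divisible by p when T_p
is divisible. In the other case, p²y = 0 puts y in T_p, so pG and pT_p have the same p-torsion. -/
theorem isNearlyDivisible_of_torsionComponent {G : Type u} [AddCommGroup G]
    (hdiv : IsDivisible (G ⧸ AddCommGroup.torsion G))
    (hrank : torsionFreeRank (G ⧸ AddCommGroup.torsion G) < Cardinal.aleph0)
    (hp : ∀ (p : ℕ) [Fact p.Prime], IsDivisible (torsionComponent G p) ∨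
      pRank p (multiple p (torsionComponent G p)) < Cardinal.aleph0) : IsNearlyDivisible G := by
  have hmod : ∀ n : ℕ, n ≠ 0 → ∀ x : G, ∃ y : G, IsOfFinAddOrder (n • y - x) := by
    intro n hn x
    obtain ⟨y, hy⟩ := hdiv n (by exact_mod_cast hn)
      (QuotientAddGroup.mk' (AddCommGroup.torsion G) x)
    obtain ⟨y, rfl⟩ := QuotientAddGroup.mk'_surjective _ y
    refine ⟨y, (QuotientAddGroup.eq_zero_iff (N := AddCommGroup.torsion G) _).1 ?_⟩
    change QuotientAddGroup.mk' (AddCommGroup.torsion G) _ = 0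
    rw [map_sub, ← hy, map_nsmul, natCast_zsmul, sub_self]
  refine ⟨?_, hmod, fun p hpp => ?_⟩
  · rw [← rank_ker_add_rank _ (QuotientAddGroup.mk'_surjective (AddCommGroup.torsion G)),
      QuotientAddGroup.ker_mk']
    have : Module.rank ℤ (AddCommGroup.torsion G) = 0 := by
      rw [rank_eq_zero_iff]
      rintro ⟨x, hx⟩
      obtain ⟨n, hn, h⟩ := isOfFinAddOrder_iff_nsmul_eq_zero.1 hx
      exact ⟨n, by exact_mod_cast hn.ne', Subtype.ext ((natCast_zsmul x n).trans h)⟩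
    rw [this, add_zero]
    exact hrank
  have : Fact p.Prime := ⟨hpp⟩
  refine (hp p).imp (fun h x => ?_) (fun h => ?_)
  · obtain ⟨y, hy⟩ := hmod p hpp.ne_zero x
    obtain ⟨v, j, hj⟩ := exists_sub_smul_primary_of_isOfFinAddOrder hpp hy 1
    rw [pow_one] at hj
    obtain ⟨z, hz⟩ := h p (by exact_mod_cast hpp.ne_zero) ⟨_, j, hj⟩
    have hz' : p • (z : G) = p • y - x - p • v • (p • y - x) :=
       (natCast_zsmul (z : G) p).symm.trans (congrArg Subtype.val hz)
    refine ⟨y - v • (p • y - x) - z, ?_⟩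
    rw [smul_sub, smul_sub, hz']
    abel
  · have := pRank_lt_aleph0_iff.1 h
    let A := multiple p (torsionComponent G p)
    refine Finite.of_injective (β := (nsmulAddMonoidHom p : A →+ A).ker)
      (fun x => ⟨⟨((x : (nsmulAddMonoidHom p : G →+ G).range) : G), ?_⟩, Subtype.ext ?_⟩) ?_
    · obtain ⟨⟨_, y, rfl⟩, hy⟩ := x
      have hy' : p • p • y = 0 := congrArg Subtype.val hy
      exact ⟨y, ⟨2, by rw [pow_two, mul_smul, hy']⟩, rfl⟩
    · have hx : p • (x : (nsmulAddMonoidHom p : G →+ G).range) = 0 := x.2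
      exact congrArg (fun z : (nsmulAddMonoidHom p : G →+ G).range => (z : G)) hx
    · intro a b hab
      exact Subtype.ext (Subtype.ext
        (congrArg (fun z : (nsmulAddMonoidHom p : A →+ A).ker => ((z : A) : G)) hab))

theorem torsionComponent.primary {G : Type u} [AddCommGroup G] {p : ℕ} [Fact p.Prime]
    (x : torsionComponent G p) : ∃ k : ℕ, p ^ k • x = 0 := by
  obtain ⟨x, k, hk⟩ := x
  exact ⟨k, Subtype.ext hk⟩

theorem IsSuperGeneralizedCoHopfian.finite_range_nsmul {G : Type u} [AddCommGroup G]
    (hG : IsSuperGeneralizedCoHopfian G) (p : ℕ) [hp : Fact p.Prime] :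
    Finite (nsmulAddMonoidHom p :
      G ⧸ (nsmulAddMonoidHom (p ^ 2) : G →+ G).range →+
        G ⧸ (nsmulAddMonoidHom (p ^ 2) : G →+ G).range).range := by
  let π := QuotientAddGroup.mk' (nsmulAddMonoidHom (p ^ 2) : G →+ G).range
  have hπ : Function.Surjective π := QuotientAddGroup.mk'_surjective _
  by_contra h
  rw [not_finite_iff_infinite] at h
  obtain ⟨f, hf⟩ := exists_surjective_of_infinite_range (p := p) (fun x => by
    obtain ⟨x, rfl⟩ := hπ x
    rw [← mul_smul, ← pow_two, ← map_nsmul]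
    exact (QuotientAddGroup.eq_zero_iff _).2 ⟨x, rfl⟩) h
  refine not_isGeneralizedCoHopfian_zmod_prod_finsupp hp.out (1 : ZMod (p ^ 2)) ?_ ?_
    (hG.of_surjective (f.comp π) (hf.comp hπ))
  · rw [nsmul_eq_mul, mul_one, Ne, ZMod.natCast_eq_zero_iff]
    intro hd
    have := Nat.le_of_dvd hp.out.pos hd
    have := hp.out.one_lt
    nlinarith
  · rw [← mul_smul, ← pow_two, nsmul_eq_mul, mul_one, ZMod.natCast_self]

/-- Suppose T_p is not divisible, so that G is not p-divisible, and A = pT_p has infinite socle.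
Finiteness of p(G/p²G) makes A/pA finite, so A contains a p-divisible subgroup with infinite socle.
Then G maps onto Prüfer^(ℕ), which forces p-divisibility. -/
theorem IsSuperGeneralizedCoHopfian.torsionComponent_divisible_or {G : Type u} [AddCommGroup G]
    (hG : IsSuperGeneralizedCoHopfian G) (p : ℕ) [hp : Fact p.Prime] :
    IsDivisible (torsionComponent G p) ∨
      pRank p (multiple p (torsionComponent G p)) < Cardinal.aleph0 := by
  refine or_iff_not_imp_left.2 fun hdiv => ?_
  rw [pRank_lt_aleph0_iff]
  have hroot : ∀ (y : G) (n : ℕ), p ^ n • y ∈ torsionComponent G p → y ∈ torsionComponent G p := by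
    rintro y n ⟨k, hk⟩
    exact ⟨k + n, by rw [pow_add, mul_smul, hk]⟩
  obtain ⟨x, hx⟩ : ∃ x : G, ∀ y : G, p • y ≠ x := by
    by_contra! h
    refine hdiv (isDivisible_of_pGroup hp.out torsionComponent.primary fun x => ?_)
    obtain ⟨y, hy⟩ := h x
    exact ⟨⟨y, hroot y 1 (by rw [pow_one, hy]; exact x.2)⟩, Subtype.ext hy⟩
  by_contra hinf
  rw [not_finite_iff_infinite] at hinf
  let A := multiple p (torsionComponent G p)
  have hA : ∀ x : A, ∃ k : ℕ, p ^ k • x = 0 := by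
    rintro ⟨_, x, ⟨k, hk⟩, rfl⟩
    refine ⟨k, Subtype.ext ?_⟩
    change p ^ k • p • x = 0
    rw [smul_comm, hk, smul_zero]
  have hfin : (nsmulAddMonoidHom p : A →+ A).range.index ≠ 0 := by
    let π := QuotientAddGroup.mk' (nsmulAddMonoidHom (p ^ 2) : G →+ G).range
    have := hG.finite_range_nsmul p
    let f : A →+ (nsmulAddMonoidHom p :
      G ⧸ (nsmulAddMonoidHom (p ^ 2) : G →+ G).range →+
        G ⧸ (nsmulAddMonoidHom (p ^ 2) : G →+ G).range).range :=
      (π.comp A.subtype).codRestrict _ (by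
        rintro ⟨_, x, hx, rfl⟩
        exact ⟨π x, (map_nsmul π p x).symm⟩)
    -- If px = p²y with x in T_p, then y is also in T_p, so px lies in pA.
    have hle : f.ker ≤ (nsmulAddMonoidHom p : A →+ A).range := by
      rintro ⟨_, x, hx, rfl⟩ h
      obtain ⟨y, hy⟩ := (QuotientAddGroup.eq_zero_iff _).1 (congrArg Subtype.val h)
      have hy' : p ^ 2 • y = p • x := hy
      have hyT : y ∈ torsionComponent G p := hroot y 2 (by rw [hy']; exact nsmul_mem hx p)
      exact ⟨⟨_, y, hyT, rfl⟩, Subtype.ext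
        ((mul_smul p p y).symm.trans ((congrArg (· • y) (pow_two p).symm).trans hy'))⟩
    have h0 : f.ker.index ≠ 0 := by
      rw [AddSubgroup.index_ker]
      exact Nat.card_pos.ne'
    exact fun h => h0 (Nat.eq_zero_of_zero_dvd (h ▸ AddSubgroup.index_dvd_of_le hle))
  obtain ⟨D, hD, hDinf⟩ := exists_divisible_subgroup_of_finite_index hp.out hA hfin hinf
  obtain ⟨f, hf⟩ := exists_surjective_of_infinite_ker_nsmul ((Prufer.isDivisible p).finsupp ℕ)
    (primary_finsupp Prufer.primary ℕ) (A.subtype.comp D.subtype)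
    (Subtype.val_injective.comp Subtype.val_injective) hD
  obtain ⟨y, hy⟩ := hG.exists_nsmul_eq_of_surjective f hf x
  exact hx y hy

/-- Infinite rank gives a map onto Prüfer^(ℕ) for every prime at once, hence divisibility by all
primes. -/
theorem IsSuperGeneralizedCoHopfian.torsionFreeRank_lt {G : Type u} [AddCommGroup G]
    (hG : IsSuperGeneralizedCoHopfian G) (hdiv : ¬ IsDivisible G) :
    torsionFreeRank (G ⧸ AddCommGroup.torsion G) < Cardinal.aleph0 := by
  by_contra! hrank
  refine hdiv (isDivisible_of_forall_prime fun p hp => ?_)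
  have : Fact p.Prime := ⟨hp⟩
  obtain ⟨f, hf⟩ := exists_surjective_of_aleph0_le_rank ((Prufer.isDivisible p).finsupp ℕ) hrank
  exact hG.exists_nsmul_eq_of_surjective
    (f.comp (QuotientAddGroup.mk' _)) (hf.comp (QuotientAddGroup.mk'_surjective _))

theorem IsGeneralizedCoBassian.isGeneralizedCoHopfian {H : Type*} [AddCommGroup H]
    (h : IsGeneralizedCoBassian H) : IsGeneralizedCoHopfian H := by
  intro φ hφ
  let e : H ⧸ (⊥ : AddSubgroup H) ≃+ H := QuotientAddGroup.quotientBot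
  have := (h ⊥ (e.symm.toAddMonoidHom.comp φ) (e.symm.injective.comp hφ)).map_equiv e
  convert this using 1
  ext y
  constructor
  · rintro ⟨x, rfl⟩
    exact ⟨_, ⟨x, rfl⟩, e.apply_symm_apply _⟩
  · rintro ⟨_, ⟨x, rfl⟩, rfl⟩
    exact ⟨x, (e.apply_symm_apply _).symm⟩

end AbGroup

theorem theorem2p49 (G : Type u) [AddCommGroup G] :
    List.TFAE [
      AbGroup.IsSuperGeneralizedCoBassian G,
      AbGroup.IsSuperGeneralizedCoHopfian G,
      AbGroup.IsDivisible G ∨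
        ((IsAddTorsionFree (G ⧸ AddCommGroup.torsion G) ∧
            AbGroup.IsDivisible (G ⧸ AddCommGroup.torsion G) ∧
            AbGroup.torsionFreeRank (G ⧸ AddCommGroup.torsion G) < Cardinal.aleph0) ∧
          ∀ (p : ℕ) [Fact p.Prime],
            AbGroup.IsDivisible (AbGroup.torsionComponent G p) ∨
              AbGroup.pRank p (AbGroup.multiple p (AbGroup.torsionComponent G p)) <
                Cardinal.aleph0)] := by
  tfae_have 1 → 2 := fun h H _ f hf => (h H f hf).isGeneralizedCoHopfian
  tfae_have 2 → 3 := by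
    intro h
    by_cases hdiv : AbGroup.IsDivisible G
    · exact Or.inl hdiv
    · exact Or.inr ⟨⟨inferInstance,
        (h _ (QuotientAddGroup.mk' _) (QuotientAddGroup.mk'_surjective _)).isDivisible,
        h.torsionFreeRank_lt hdiv⟩, fun p _ => h.torsionComponent_divisible_or p⟩
  tfae_have 3 → 1 := by
    rintro (hdiv | ⟨⟨_, hdiv, hrank⟩, hp⟩) H _ f hf
    · exact (hdiv.of_surjective f hf).isGeneralizedCoBassian
    · exact ((AbGroup.isNearlyDivisible_of_torsionComponent hdiv hrank hp).of_surjective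
        f hf).isGeneralizedCoBassian
  tfae_finish
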